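/- Let $X=(X,d,\mu)$ be a separable metric space equipped with a locally finite Borel measure $\mu$ that is positive on nonempty open sets, let $Z$ be a metric space, let $1<p<\infty$, and let $u\colon X\to Z$ be a Borel map with $u\in L^p(X,Z)$, i.e. $x\mapsto d(z,u(x))$ is in $L^p(X,\mu)$ for some $z\in Z$. A curve in a metric space is a continuous map $\gamma\colon[a,b]\to X$ on a closed interval; it is rectifiable if its length $l(\gamma)$ is finite, and then $\int_\gamma\rho\,ds=\int_0^{l(\gamma)}\rho(\gamma_s(t))\,dt$ for Borel $\rho\colon X\to[0,\infty]$, where $\gamma_s$ is the arc-length parametrization of $\gamma$. For a family $\Gamma$ of curves in $X$, $$\mathrm{Mod}_p(\Gamma)=\inf\Big\{\int_X\rho^p\,d\mu \;:\; \rho\colon X\to[0,\infty]\text{ Borel},\ \int_\gamma\rho\,ds\ge 1\text{ for every rectifiable }\gamma\in\Gamma\Big\},$$ and a property holds for $p$-almost every curve if it fails only on a family of curves of $p$-modulus $0$. A Borel function $g\colon X\to[0,\infty]$ is an upper gradient of $u$ if $$d\big(u(\gamma(a)),u(\gamma(b))\big)\le\int_\gamma g\,ds$$ for every rectifiable curve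 $\gamma\colon[a,b]\to X$, and a $p$-weak upper gradient of $u$ if this holds for $p$-almost every rectifiable curve. We write $u\in N^{1,p}(X,Z)$ if $u\in L^p(X,Z)$ and $u$ has an upper gradient in $L^p(X)$. A minimal $p$-weak upper gradient of $u$ is a $p$-weak upper gradient $g_u\in L^p_{\mathrm{loc}}(X)$ such that $g_u\le g$ $\mu$-almost everywhere for every $p$-weak upper gradient $g\in L^p_{\mathrm{loc}}(X)$ of $u$. For $\epsilon>0$ let $E_\epsilon(u)$ be the family of all curves $\gamma\colon[a,b]\to X$ with $d(u(\gamma(a)),u(\gamma(b)))\ge\epsilon$, and let $u^{-1}(\Gamma_\epsilon(Z))\subseteq E_\epsilon(u)$ be the subfamily of those $\gamma$ for which moreover $u\circ\gamma$ is continuous, i.e. for which $u\circ\gamma$ belongs to the family $\Gamma_\epsilon(Z)$ of curves in $Z$ whose endpoints are at distance at least $\epsilon$. (The two families coincide if $u$ is continuous.) **Theorem.** 1. $u\in N^{1,p}(X,Z)$ if and only if $\displaystyle\liminf_{\epsilon\to0^+}\epsilon^p\,\mathrm{Mod}_p(E_\epsilon(u))<\infty$. 2. If $u\circ\gamma$ is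 continuous for $p$-almost every curve $\gamma$ in $X$, then $u\in N^{1,p}(X,Z)$ if and only if $\displaystyle\liminf_{\epsilon\to0^+}\epsilon^p\,\mathrm{Mod}_p\big(u^{-1}(\Gamma_\epsilon(Z))\big)<\infty$. 3. If $u\in N^{1,p}(X,Z)$, then $u$ has a minimal $p$-weak upper gradient, and for every such $g_u$ both lower limits are limits and $$\lim_{\epsilon\to0^+}\epsilon^p\,\mathrm{Mod}_p(E_\epsilon(u))=\lim_{\epsilon\to0^+}\epsilon^p\,\mathrm{Mod}_p\big(u^{-1}(\Gamma_\epsilon(Z))\big)=\int_X g_u^p\,d\mu.$$ -/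

import Mathlib

open MeasureTheory Filter Topology Set
open scoped ENNReal

noncomputable section

namespace CurveModulus

/-- A curve in `X`: a continuous map on a closed interval `[left, right]`. The values of `toFun`
outside of the interval are irrelevant; everything below only looks at the interval. -/
structure Curve (X : Type*) [TopologicalSpace X] where
  left : ℝ
  right : ℝ
  left_le_right : left ≤ right
  toFun : ℝ → X
  continuousOn_toFun : ContinuousOn toFun (Icc left right)

namespace Curve

/-- The length of a curve, i.e. its total variation. -/
def length {X : Type*} [MetricSpace X] (γ : Curve X) : ℝ≥0∞ :=
  eVariationOn γ.toFun (Icc γ.left γ.right)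

/-- A curve is rectifiable if its length is finite. -/
def Rectifiable {X : Type*} [MetricSpace X] (γ : Curve X) : Prop :=
  γ.length < ∞

/-- The arc-length parametrization `γ_s` of a rectifiable curve `γ`: on `[0, l(γ)]` it is determined
by `γ_s (v_γ t) = γ t`, where `v_γ t` is the variation of `γ` on `[left, t]`. -/
def arcLengthParam {X : Type*} [MetricSpace X] (γ : Curve X) : ℝ → X :=
  naturalParameterization γ.toFun (Icc γ.left γ.right) γ.left

/-- The integral `∫_γ ρ ds = ∫_0^{l(γ)} ρ (γ_s t) dt` of `ρ` along a rectifiable curve. -/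
def integral {X : Type*} [MetricSpace X] (γ : Curve X) (ρ : X → ℝ≥0∞) : ℝ≥0∞ :=
  ∫⁻ t in Icc (0 : ℝ) γ.length.toReal, ρ (γ.arcLengthParam t)

end Curve

/-- A Borel function `ρ : X → [0, ∞]` is admissible for a family `Γ` of curves if `∫_γ ρ ds ≥ 1`
for every rectifiable `γ ∈ Γ`. -/
def Admissible {X : Type*} [MetricSpace X] [MeasurableSpace X]
    (Γ : Set (Curve X)) (ρ : X → ℝ≥0∞) : Prop :=
  Measurable ρ ∧ ∀ γ ∈ Γ, γ.Rectifiable → 1 ≤ γ.integral ρ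

/-- The `p`-modulus of a family of curves. -/
def modulus {X : Type*} [MetricSpace X] [MeasurableSpace X] (μ : Measure X) (p : ℝ)
    (Γ : Set (Curve X)) : ℝ≥0∞ :=
  ⨅ (ρ : X → ℝ≥0∞) (_ : Admissible Γ ρ), ∫⁻ x, ρ x ^ p ∂μ

/-- A property holds for `p`-almost every curve if it fails only on a family of modulus zero. -/
def AlmostEveryCurve {X : Type*} [MetricSpace X] [MeasurableSpace X] (μ : Measure X) (p : ℝ)
    (P : Curve X → Prop) : Prop :=
  modulus μ p {γ | ¬ P γ} = 0

/-- `u` is continuous along `γ` if `u ∘ γ` is continuous on the parametrizing interval. -/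
def ContinuousAlong {X Z : Type*} [TopologicalSpace X] [TopologicalSpace Z] (u : X → Z)
    (γ : Curve X) : Prop :=
  ContinuousOn (u ∘ γ.toFun) (Icc γ.left γ.right)

/-- The upper gradient inequality `d(u(γ(b)), u(γ(a))) ≤ ∫_γ g ds` on the curve `γ`. -/
def UpperGradientIneq {X Z : Type*} [MetricSpace X] [MetricSpace Z] (u : X → Z)
    (g : X → ℝ≥0∞) (γ : Curve X) : Prop :=
  edist (u (γ.toFun γ.right)) (u (γ.toFun γ.left)) ≤ γ.integral g

/-- `g` is an upper gradient of `u`. -/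
def IsUpperGradient {X Z : Type*} [MetricSpace X] [MeasurableSpace X] [MetricSpace Z]
    (u : X → Z) (g : X → ℝ≥0∞) : Prop :=
  Measurable g ∧ ∀ γ : Curve X, γ.Rectifiable → UpperGradientIneq u g γ

/-- `g` is a `p`-weak upper gradient of `u`. -/
def IsWeakUpperGradient {X Z : Type*} [MetricSpace X] [MeasurableSpace X] [MetricSpace Z]
    (μ : Measure X) (p : ℝ) (u : X → Z) (g : X → ℝ≥0∞) : Prop :=
  Measurable g ∧ AlmostEveryCurve μ p fun γ => γ.Rectifiable → UpperGradientIneq u g γ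

/-- Local `p`-integrability of a nonnegative function. -/
def LocallyLp {X : Type*} [MetricSpace X] [MeasurableSpace X] (μ : Measure X) (p : ℝ)
    (g : X → ℝ≥0∞) : Prop :=
  ∀ x : X, ∃ U ∈ 𝓝 x, ∫⁻ y in U, g y ^ p ∂μ < ∞

/-- `g` is a minimal `p`-weak upper gradient of `u`: it is a locally `p`-integrable `p`-weak upper
gradient, and it is almost everywhere at most every other one. -/
def IsMinimalWeakUpperGradient {X Z : Type*} [MetricSpace X] [MeasurableSpace X] [MetricSpace Z]
    (μ : Measure X) (p : ℝ) (u : X → Z) (g : X → ℝ≥0∞) : Prop :=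
  IsWeakUpperGradient μ p u g ∧ LocallyLp μ p g ∧
    ∀ g' : X → ℝ≥0∞, IsWeakUpperGradient μ p u g' → LocallyLp μ p g' → ∀ᵐ x ∂μ, g x ≤ g' x

/-- `u ∈ L^p(X, Z)`: the distance from `u` to some point of `Z` is in `L^p(X)`. -/
def MemLpMetric {X Z : Type*} [MeasurableSpace X] [MetricSpace Z]
    (μ : Measure X) (p : ℝ) (u : X → Z) : Prop :=
  ∃ z : Z, MemLp (fun x => dist z (u x)) (ENNReal.ofReal p) μ

/-- `u` is in the Newton-Sobolev class `N^{1,p}(X, Z)`. -/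
def MemNewtonSobolev {X Z : Type*} [MetricSpace X] [MeasurableSpace X] [MetricSpace Z]
    (μ : Measure X) (p : ℝ) (u : X → Z) : Prop :=
  MemLpMetric μ p u ∧ ∃ g : X → ℝ≥0∞, IsUpperGradient u g ∧ ∫⁻ x, g x ^ p ∂μ < ∞

/-- The family of curves `γ` in `X` such that `u` moves the endpoints of `γ` to points at distance
at least `ε`. No continuity of `u ∘ γ` is required. -/
def farEndpoints {X Z : Type*} [MetricSpace X] [MetricSpace Z] (u : X → Z) (ε : ℝ) :
    Set (Curve X) :=
  {γ | ε ≤ dist (u (γ.toFun γ.right)) (u (γ.toFun γ.left))}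

/-- The family `Γ_ε(Z)` of curves in `Z` whose endpoints are at distance at least `ε`. -/
def bigCurves (Z : Type*) [MetricSpace Z] (ε : ℝ) : Set (Curve Z) :=
  {σ | ε ≤ dist (σ.toFun σ.right) (σ.toFun σ.left)}

/-- The family `u⁻¹(Γ)` of the curves `γ` in `X` such that `u ∘ γ` is a curve (in particular
continuous) that belongs to `Γ`. -/
def preimageFamily {X Z : Type*} [MetricSpace X] [MetricSpace Z] (u : X → Z)
    (Γ : Set (Curve Z)) : Set (Curve X) :=
  {γ | ∃ h : ContinuousAlong u γ, (⟨γ.left, γ.right, γ.left_le_right, u ∘ γ.toFun, h⟩ : Curve Z) ∈ Γ}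

end CurveModulus

end

open CurveModulus

open CurveModulus

/-! If `g` is a weak upper gradient, then `g / ε` is admissible for $E_\epsilon(u)$ off an
exceptional family, so $\epsilon^p\,\mathrm{Mod}_p(E_\epsilon(u)) \le \int g^p\,d\mu$ for every
$\epsilon > 0$ (`IsWeakUpperGradient.rpow_mul_modulus_le`).

The substance is the converse: when the lower limit $L$ is finite, some weak upper gradient
satisfies $\int g^p\,d\mu \le L$ (`exists_isWeakUpperGradient_of_modulus`). Let ρ be admissible for
$E_\epsilon(u)$. An arc on which the integral of ερ is less than ε is not in $E_\epsilon(u)$, so `u`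
moves its endpoints by less than ε. Cutting a curve into such arcs shows that ερ is an upper
gradient up to a single additive error ε (`Admissible.edist_le_add`). The functions that are upper
gradients up to an error $1/(n+1)$ on almost every curve form midpoint convex classes that decrease
in $n$. By uniform convexity, near-minimizers of the $L^p$ norm in these classes have a rapidly
converging subsequence (`exists_selection_of_midpoint_mem`). Fuglede's argument then passes to the
limit on almost every curve.

Thus $L$ is at most $\int g'^p\,d\mu$ for every weak upper gradient `g'`, and it is attained by some
`g`. For locally `p`-integrable `g'`, the function `min g g'` is again a weak upper gradient, by
differentiation along curves (`IsWeakUpperGradient.min`). Its integral cannot drop below $L$, so `g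
≤ g'` almost everywhere: `g` is minimal. The first bound caps the upper limit by the same integral,
hence the limit exists. Finally, a `p`-integrable weak upper gradient makes `u` continuous along
almost every curve, so the two families of curves have the same modulus. -/

/-! ### Unit speed reparametrization of rectifiable curves. -/

theorem LocallyBoundedVariationOn.continuousOn_variationOnFromTo {E : Type*} [PseudoMetricSpace E]
    {f : ℝ → E} {s : Set ℝ} {a : ℝ} (hf : LocallyBoundedVariationOn f s) (hc : ContinuousOn f s)
    (ha : a ∈ s) : ContinuousOn (variationOnFromTo f s a) s := by
  intro b hb
  -- The one-sided limits of the variation are known at a point of one-sided continuity, so the two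
  -- sides are treated separately.
  have hs : s ⊆ (s ∩ Iio b) ∪ ({b} ∪ (s ∩ Ioi b)) := by
    intro t ht
    rcases lt_trichotomy t b with h | h | h
    · exact Or.inl ⟨ht, h⟩
    · exact Or.inr (Or.inl h)
    · exact Or.inr (Or.inr ⟨ht, h⟩)
  refine ContinuousWithinAt.mono ?_ hs
  refine ContinuousWithinAt.union ?_ (ContinuousWithinAt.union continuousWithinAt_singleton ?_)
  · have := variationOnFromTo.tendsto_left ha hb hf ((hc b hb).mono inter_subset_left)
    simpa [ContinuousWithinAt] using this
  · have := variationOnFromTo.tendsto_right ha hb hf ((hc b hb).mono inter_subset_left)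
    simpa [ContinuousWithinAt] using this

theorem HasUnitSpeedOn.mono {E : Type*} [PseudoEMetricSpace E] {f : ℝ → E} {a b x y : ℝ}
    (h : HasUnitSpeedOn f (Icc a b)) (hx : a ≤ x) (hy : y ≤ b) : HasUnitSpeedOn f (Icc x y) := by
  intro s hs t ht
  rw [← h ⟨hx.trans hs.1, hs.2.trans hy⟩ ⟨hx.trans ht.1, ht.2.trans hy⟩, Icc_inter_Icc,
    Icc_inter_Icc, sup_of_le_right hs.1, inf_of_le_right ht.2, sup_of_le_right (hx.trans hs.1),
    inf_of_le_right (ht.2.trans hy)]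

theorem HasUnitSpeedOn.congr {E : Type*} [PseudoEMetricSpace E] {f g : ℝ → E} {s : Set ℝ}
    (h : HasUnitSpeedOn f s) (hfg : EqOn f g s) : HasUnitSpeedOn g s := by
  intro x hx y hy
  rw [← h hx hy]
  exact (eVariationOn.congr (hfg.mono inter_subset_left)).symm

theorem HasUnitSpeedOn.lipschitzOnWith {E : Type*} [PseudoEMetricSpace E] {f : ℝ → E} {s : Set ℝ}
    (h : HasUnitSpeedOn f s) : LipschitzOnWith 1 f s := by
  intro x hx y hy
  wlog hxy : x ≤ y generalizing x y
  · rw [edist_comm, edist_comm x]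
    exact this hy hx (not_le.1 hxy).le
  calc edist (f x) (f y) ≤ eVariationOn f (s ∩ Icc x y) :=
        eVariationOn.edist_le f ⟨hx, le_rfl, hxy⟩ ⟨hy, hxy, le_rfl⟩
    _ = ENNReal.ofReal (y - x) := by rw [h hx hy]; simp
    _ = (1 : NNReal) * edist x y := by
        rw [edist_comm, edist_dist, Real.dist_eq, abs_of_nonneg (sub_nonneg.2 hxy)]; simp

namespace CurveModulus

namespace Curve

variable {X : Type*} [MetricSpace X]

/-- The arc of a unit speed parametrization between two parameters. -/
def arc (c : ℝ → X) (hc : Continuous c) (x y : ℝ) (hxy : x ≤ y) : Curve X :=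
  ⟨x, y, hxy, c, hc.continuousOn⟩

theorem length_arc {c : ℝ → X} (hc : Continuous c) {x y : ℝ} (hxy : x ≤ y)
    (h : HasUnitSpeedOn c (Icc x y)) : (arc c hc x y hxy).length = ENNReal.ofReal (y - x) := by
  have := h (left_mem_Icc.2 hxy) (right_mem_Icc.2 hxy)
  rw [inter_self] at this
  simpa [length, arc] using this

theorem rectifiable_arc {c : ℝ → X} (hc : Continuous c) {x y : ℝ} (hxy : x ≤ y)
    (h : HasUnitSpeedOn c (Icc x y)) : (arc c hc x y hxy).Rectifiable := by
  rw [Rectifiable, length_arc hc hxy h]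
  exact ENNReal.ofReal_lt_top

theorem integral_arc {c : ℝ → X} (hc : Continuous c) {x y : ℝ} (hxy : x ≤ y)
    (h : HasUnitSpeedOn c (Icc x y)) (ρ : X → ℝ≥0∞) :
    (arc c hc x y hxy).integral ρ = ∫⁻ t in Icc x y, ρ (c t) := by
  have hv := (hasConstantSpeedOnWith_iff_variationOnFromTo_eq.1 h)
  have h1 : ∀ t ∈ Icc 0 (y - x), ρ ((arc c hc x y hxy).arcLengthParam t) = ρ (c (x + t)) := by
    intro t ht
    have hxt : x + t ∈ Icc x y := ⟨by linarith [ht.1], by linarith [ht.2]⟩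
    have h2 := edist_naturalParameterization_eq_zero hv.1 (left_mem_Icc.2 hxy) hxt
    rw [hv.2 (left_mem_Icc.2 hxy) hxt] at h2
    have h3 := edist_eq_zero.1 h2
    simp only [NNReal.coe_one, add_sub_cancel_left, one_mul] at h3
    simp only [arcLengthParam, arc, h3]
  rw [integral, length_arc hc hxy h, ENNReal.toReal_ofReal (sub_nonneg.2 hxy),
    setLIntegral_congr_fun measurableSet_Icc h1]
  have h4 := (measurePreserving_add_left (volume : Measure ℝ) x).setLIntegral_comp_preimage_emb
    (MeasurableEquiv.addLeft x).measurableEmbedding (fun t => ρ (c t)) (Icc x y)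
  rw [← h4]
  simp

/-- A rectifiable curve has a unit speed reparametrization, and integrals along the curve are
integrals along this reparametrization. -/
theorem Rectifiable.exists_unitSpeed {γ : Curve X} (hγ : γ.Rectifiable) :
    ∃ (c : ℝ → X) (l : ℝ) (v : ℝ → ℝ), Continuous c ∧ 0 ≤ l ∧ HasUnitSpeedOn c (Icc 0 l) ∧
      c 0 = γ.toFun γ.left ∧ c l = γ.toFun γ.right ∧
      (∀ ρ : X → ℝ≥0∞, γ.integral ρ = ∫⁻ t in Icc 0 l, ρ (c t)) ∧
      ContinuousOn v (Icc γ.left γ.right) ∧ MapsTo v (Icc γ.left γ.right) (Icc 0 l) ∧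
      ∀ t ∈ Icc γ.left γ.right, γ.toFun t = c (v t) := by
  set I := Icc γ.left γ.right with hI
  have hl : γ.left ∈ I := left_mem_Icc.2 γ.left_le_right
  have hr : γ.right ∈ I := right_mem_Icc.2 γ.left_le_right
  have hbv : LocallyBoundedVariationOn γ.toFun I :=
    BoundedVariationOn.locallyBoundedVariationOn (ne_of_lt hγ)
  set v := variationOnFromTo γ.toFun I γ.left with hv
  set l := γ.length.toReal with hlen
  have hl0 : 0 ≤ l := ENNReal.toReal_nonneg
  have hvl : v γ.left = 0 := variationOnFromTo.self _ _ _
  have hvr : v γ.right = l := by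
    rw [hv, variationOnFromTo.eq_of_le _ _ γ.left_le_right, hI, inter_self]; rfl
  have hmono : MonotoneOn v I := variationOnFromTo.monotoneOn hbv hl
  have hvc : ContinuousOn v I :=
    hbv.continuousOn_variationOnFromTo γ.continuousOn_toFun hl
  have hmaps : MapsTo v I (Icc 0 l) := fun t ht =>
    ⟨hvl ▸ hmono hl ht ht.1, hvr ▸ hmono ht hr ht.2⟩
  have himg : v '' I = Icc 0 l := by
    refine hmaps.image_subset.antisymm ?_
    have := intermediate_value_Icc γ.left_le_right hvc
    rwa [hvl, hvr] at this
  have hspeed : HasUnitSpeedOn γ.arcLengthParam (Icc 0 l) := by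
    rw [← himg]; exact has_unit_speed_naturalParameterization γ.toFun hbv hl
  -- The arc-length parametrization is only controlled on `[0, l]`; extending it by constants gives
  -- a globally continuous `c`, so that `ρ ∘ c` is measurable for Borel `ρ`.
  have hEq : EqOn γ.arcLengthParam (IccExtend hl0 ((Icc 0 l).domRestrict γ.arcLengthParam))
      (Icc 0 l) := fun t ht => by rw [IccExtend_of_mem _ _ ht]; rfl
  have hpar : ∀ t ∈ I, γ.toFun t = γ.arcLengthParam (v t) := fun t ht =>
    (edist_eq_zero.1 (edist_naturalParameterization_eq_zero hbv hl ht)).symm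
  refine ⟨IccExtend hl0 ((Icc 0 l).domRestrict γ.arcLengthParam), l, v, ?_, hl0, hspeed.congr hEq,
    ?_, ?_, fun ρ => ?_, hvc, hmaps, fun t ht => ?_⟩
  · exact (continuousOn_iff_continuous_domRestrict.1 hspeed.lipschitzOnWith.continuousOn).Icc_extend'
  · rw [← hEq ⟨le_rfl, hl0⟩, hpar _ hl, hvl]
  · rw [← hEq ⟨hl0, le_rfl⟩, hpar _ hr, hvr]
  · exact setLIntegral_congr_fun measurableSet_Icc fun t ht => congrArg ρ (hEq ht)
  · rw [← hEq (hmaps ht), hpar _ ht]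

end Curve

end CurveModulus

/-! ### Countable sums in $L^p$ without the triangle inequality. -/

section Lp

theorem ENNReal.iSup_rpow_le_tsum {ι : Type*} {p : ℝ} (hp : 0 < p) (a : ι → ℝ≥0∞) :
    (⨆ i, a i) ^ p ≤ ∑' i, a i ^ p := by
  rw [← ENNReal.le_rpow_inv_iff hp]
  exact iSup_le fun i => (ENNReal.le_rpow_inv_iff hp).2 (ENNReal.le_tsum i)

theorem ENNReal.sup_rpow_le_add (p : ℝ) (a b : ℝ≥0∞) :
    (a ⊔ b) ^ p ≤ a ^ p + b ^ p := by
  rcases le_total a b with h | h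
  · rw [sup_of_le_right h]; exact le_add_self
  · rw [sup_of_le_left h]; exact le_self_add

/-- Since the weights $2^{-(n+1)}$ have sum 1, a series is at most the supremum of $2^{n+1} a_n$,
and the `p`-th power of a supremum is at most the sum of the `p`-th powers. -/
theorem ENNReal.tsum_rpow_le {p : ℝ} (hp : 0 < p) (a : ℕ → ℝ≥0∞) :
    (∑' n, a n) ^ p ≤ ∑' n, ((2 : ℝ≥0∞) ^ (n + 1)) ^ p * a n ^ p := by
  have h2 : ∀ n : ℕ, (2 : ℝ≥0∞)⁻¹ ^ (n + 1) * 2 ^ (n + 1) = 1 := fun n => by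
    rw [← mul_pow, ENNReal.inv_mul_cancel two_ne_zero ENNReal.ofNat_ne_top, one_pow]
  have h1 : ∑' n, a n ≤ ⨆ n, 2 ^ (n + 1) * a n := by
    calc ∑' n, a n = ∑' n : ℕ, (2 : ℝ≥0∞)⁻¹ ^ (n + 1) * (2 ^ (n + 1) * a n) := by
          refine tsum_congr fun n => ?_
          rw [← mul_assoc, h2, one_mul]
      _ ≤ ∑' n : ℕ, (2 : ℝ≥0∞)⁻¹ ^ (n + 1) * ⨆ n, 2 ^ (n + 1) * a n :=
          ENNReal.tsum_le_tsum fun n => by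
            gcongr; exact le_iSup (fun n => (2 : ℝ≥0∞) ^ (n + 1) * a n) n
      _ = ⨆ n, 2 ^ (n + 1) * a n := by
          rw [ENNReal.tsum_mul_right, ENNReal.tsum_geometric_add_one, ENNReal.one_sub_inv_two,
            inv_inv, ENNReal.inv_mul_cancel two_ne_zero ENNReal.ofNat_ne_top, one_mul]
  calc (∑' n, a n) ^ p ≤ (⨆ n, 2 ^ (n + 1) * a n) ^ p := ENNReal.rpow_le_rpow h1 hp.le
    _ ≤ ∑' n, (2 ^ (n + 1) * a n) ^ p := ENNReal.iSup_rpow_le_tsum hp _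
    _ = _ := tsum_congr fun n => ENNReal.mul_rpow_of_nonneg _ _ hp.le

/-- Positive weights such that functions whose `p`-th powers have integrals below the weights are
summable in `L^p`. -/
noncomputable def summabilityWeight (p : ℝ) (n : ℕ) : ℝ≥0∞ :=
  (((2 : ℝ≥0∞) ^ (n + 1)) ^ p)⁻¹ * 2⁻¹ ^ n

theorem summabilityWeight_pos {p : ℝ} (hp : 0 < p) (n : ℕ) : 0 < summabilityWeight p n := by
  refine ENNReal.mul_pos (ENNReal.inv_ne_zero.2 ?_) (by simp)
  exact ENNReal.rpow_ne_top_of_nonneg hp.le (by simp)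

theorem lintegral_tsum_rpow_lt_top {α : Type*} [MeasurableSpace α] {μ : Measure α} {p : ℝ}
    (hp : 0 < p) {a : ℕ → α → ℝ≥0∞} (ha : ∀ n, Measurable (a n))
    (h : ∀ n, ∫⁻ x, a n x ^ p ∂μ ≤ summabilityWeight p n) :
    ∫⁻ x, (∑' n, a n x) ^ p ∂μ < ∞ := by
  have hne : ∀ n : ℕ, ((2 : ℝ≥0∞) ^ (n + 1)) ^ p ≠ ∞ := fun n =>
    ENNReal.rpow_ne_top_of_nonneg hp.le (by simp)
  have hpos : ∀ n : ℕ, ((2 : ℝ≥0∞) ^ (n + 1)) ^ p ≠ 0 := fun n => by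
    simp [ENNReal.rpow_eq_zero_iff, hp.not_gt]
  calc ∫⁻ x, (∑' n, a n x) ^ p ∂μ
      ≤ ∫⁻ x, ∑' n, ((2 : ℝ≥0∞) ^ (n + 1)) ^ p * a n x ^ p ∂μ :=
        lintegral_mono fun x => ENNReal.tsum_rpow_le hp _
    _ = ∑' n, ((2 : ℝ≥0∞) ^ (n + 1)) ^ p * ∫⁻ x, a n x ^ p ∂μ := by
        rw [lintegral_tsum fun n => (((ha n).pow_const p).const_mul _).aemeasurable]
        exact tsum_congr fun n => lintegral_const_mul' _ _ (hne n)
    _ ≤ ∑' n, ((2 : ℝ≥0∞) ^ (n + 1)) ^ p * summabilityWeight p n :=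
        ENNReal.tsum_le_tsum fun n => by gcongr; exact h n
    _ = ∑' n : ℕ, (2 : ℝ≥0∞)⁻¹ ^ n := by
        refine tsum_congr fun n => ?_
        rw [summabilityWeight, ← mul_assoc, ENNReal.mul_inv_cancel (hpos n) (hne n), one_mul]
    _ < ∞ := by
        rw [ENNReal.tsum_geometric, ENNReal.one_sub_inv_two, inv_inv]
        exact ENNReal.ofNat_lt_top

theorem lintegral_const_mul_rpow {α : Type*} [MeasurableSpace α] {μ : Measure α} {p : ℝ}
    (hp : 0 < p) {r : ℝ≥0∞} (hr : r ≠ ∞) (ρ : α → ℝ≥0∞) :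
    ∫⁻ x, (r * ρ x) ^ p ∂μ = r ^ p * ∫⁻ x, ρ x ^ p ∂μ := by
  simp_rw [ENNReal.mul_rpow_of_nonneg _ _ hp.le]
  exact lintegral_const_mul' _ _ (ENNReal.rpow_ne_top_of_nonneg hp.le hr)

theorem tendsto_inv_nat_rpow_mul {p : ℝ} (hp : 0 < p) {M : ℝ≥0∞} (hM : M < ∞) :
    Tendsto (fun n : ℕ => ((n + 1 : ℕ) : ℝ≥0∞)⁻¹ ^ p * M) atTop (𝓝 0) := by
  have h1 : Tendsto (fun n : ℕ => ((n + 1 : ℕ) : ℝ≥0∞)⁻¹) atTop (𝓝 0) :=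
    ENNReal.tendsto_inv_nat_nhds_zero.comp (tendsto_add_atTop_nat 1)
  have h2 : Tendsto (fun n : ℕ => ((n + 1 : ℕ) : ℝ≥0∞)⁻¹ ^ p) atTop (𝓝 0) := by
    have := (ENNReal.continuous_rpow_const (y := p)).tendsto (0 : ℝ≥0∞)
    rw [ENNReal.zero_rpow_of_pos hp] at this
    exact this.comp h1
  simpa using ENNReal.Tendsto.mul_const h2 (Or.inr hM.ne)

end Lp

/-! ### Modulus and exceptional families of curves. -/

namespace CurveModulus

variable {X : Type*} [MetricSpace X]

namespace Curve

variable {γ : Curve X}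

theorem integral_mono {ρ σ : X → ℝ≥0∞} (h : ρ ≤ σ) : γ.integral ρ ≤ γ.integral σ :=
  lintegral_mono fun _ => h _

theorem integral_const_mul {r : ℝ≥0∞} (hr : r ≠ ∞) (ρ : X → ℝ≥0∞) :
    γ.integral (fun x => r * ρ x) = r * γ.integral ρ :=
  lintegral_const_mul' _ _ hr

variable [MeasurableSpace X] [BorelSpace X]

theorem Rectifiable.integral_add (hγ : γ.Rectifiable) {ρ σ : X → ℝ≥0∞} (hρ : Measurable ρ) :
    γ.integral (fun x => ρ x + σ x) = γ.integral ρ + γ.integral σ := by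
  obtain ⟨c, l, -, hc, -, -, -, -, h, -⟩ := hγ.exists_unitSpeed
  simp only [h]
  exact lintegral_add_left (hρ.comp hc.measurable) _

theorem Rectifiable.integral_tsum (hγ : γ.Rectifiable) {ρ : ℕ → X → ℝ≥0∞}
    (hρ : ∀ n, Measurable (ρ n)) :
    γ.integral (fun x => ∑' n, ρ n x) = ∑' n, γ.integral (ρ n) := by
  obtain ⟨c, l, -, hc, -, -, -, -, h, -⟩ := hγ.exists_unitSpeed
  simp only [h]
  exact lintegral_tsum fun n => ((hρ n).comp hc.measurable).aemeasurable

end Curve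

variable [MeasurableSpace X] {μ : Measure X} {p : ℝ}

theorem modulus_le {Γ : Set (Curve X)} {ρ : X → ℝ≥0∞} (h : Admissible Γ ρ) :
    modulus μ p Γ ≤ ∫⁻ x, ρ x ^ p ∂μ :=
  iInf₂_le ρ h

theorem exists_admissible_of_modulus_lt {Γ : Set (Curve X)} {m : ℝ≥0∞} (h : modulus μ p Γ < m) :
    ∃ ρ, Admissible Γ ρ ∧ ∫⁻ x, ρ x ^ p ∂μ < m := by
  simpa [modulus, iInf_lt_iff] using h

/-- To bound the modulus of a family it is enough to have admissibility off an exceptional family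
along which a `p`-integrable function has infinite integrals. -/
theorem modulus_le_of_exceptional (hp : 0 < p) {Γ : Set (Curve X)} {ρ ρ₀ : X → ℝ≥0∞}
    (hρ : Measurable ρ) (hρ₀ : Measurable ρ₀) (hfin : ∫⁻ x, ρ₀ x ^ p ∂μ < ∞)
    (h : ∀ γ ∈ Γ, γ.Rectifiable → γ.integral ρ₀ < ∞ → 1 ≤ γ.integral ρ) :
    modulus μ p Γ ≤ ∫⁻ x, ρ x ^ p ∂μ := by
  have hlim := (tendsto_inv_nat_rpow_mul hp hfin).const_add (∫⁻ x, ρ x ^ p ∂μ)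
  rw [add_zero] at hlim
  refine ge_of_tendsto' hlim fun n => ?_
  have hr : ((n + 1 : ℕ) : ℝ≥0∞)⁻¹ ≠ ∞ := by simp
  have hr0 : ((n + 1 : ℕ) : ℝ≥0∞)⁻¹ ≠ 0 := ENNReal.inv_ne_zero.2 (ENNReal.natCast_ne_top _)
  set r := ((n + 1 : ℕ) : ℝ≥0∞)⁻¹
  -- However small `r > 0` is, `r * ρ₀` still has infinite integral along the exceptional curves,
  -- while its cost $r^p \int \rho_0^p$ tends to 0.
  have hadm : Admissible Γ (fun x => ρ x ⊔ r * ρ₀ x) := by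
    refine ⟨hρ.sup (hρ₀.const_mul r), fun γ hγ hrect => ?_⟩
    rcases eq_or_ne (γ.integral ρ₀) ∞ with htop | htop
    · refine le_trans ?_ (Curve.integral_mono (ρ := fun x => r * ρ₀ x) fun x => le_sup_right)
      rw [Curve.integral_const_mul hr, htop, ENNReal.mul_top hr0]
      exact le_top
    · exact (h γ hγ hrect htop.lt_top).trans (Curve.integral_mono fun x => le_sup_left)
  calc modulus μ p Γ ≤ ∫⁻ x, (ρ x ⊔ r * ρ₀ x) ^ p ∂μ := modulus_le hadm
    _ ≤ ∫⁻ x, ρ x ^ p + (r * ρ₀ x) ^ p ∂μ :=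
        lintegral_mono fun x => ENNReal.sup_rpow_le_add p _ _
    _ = ∫⁻ x, ρ x ^ p ∂μ + r ^ p * ∫⁻ x, ρ₀ x ^ p ∂μ := by
        rw [lintegral_add_left (hρ.pow_const p), lintegral_const_mul_rpow hp hr]

/-- A property holds on almost every curve if and only if it holds on all rectifiable curves along
which a suitable `p`-integrable function has a finite integral. -/
theorem almostEveryCurve_iff [BorelSpace X] (hp : 0 < p) {P : Curve X → Prop} :
    AlmostEveryCurve μ p P ↔ ∃ ρ : X → ℝ≥0∞, Measurable ρ ∧ ∫⁻ x, ρ x ^ p ∂μ < ∞ ∧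
      ∀ γ : Curve X, γ.Rectifiable → γ.integral ρ < ∞ → P γ := by
  constructor
  · intro h
    -- Each `ρ n` has integral at least 1 along every bad rectifiable curve, so their sum has
    -- infinite integral there, yet the weights keep the sum in $L^p$.
    have h1 : ∀ n, ∃ ρ, Admissible {γ | ¬ P γ} ρ ∧ ∫⁻ x, ρ x ^ p ∂μ < summabilityWeight p n :=
      fun n => exists_admissible_of_modulus_lt (h.trans_lt (summabilityWeight_pos hp n))
    choose ρ hadm hlt using h1
    refine ⟨fun x => ∑' n, ρ n x, Measurable.tsum fun n => (hadm n).1,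
      lintegral_tsum_rpow_lt_top hp (fun n => (hadm n).1) fun n => (hlt n).le,
      fun γ hγ hfin => ?_⟩
    by_contra hP
    rw [hγ.integral_tsum fun n => (hadm n).1] at hfin
    have : ∑' _ : ℕ, (1 : ℝ≥0∞) ≤ ∑' n, γ.integral (ρ n) :=
      ENNReal.tsum_le_tsum fun n => (hadm n).2 γ hP hγ
    rw [ENNReal.tsum_const_eq_top_of_ne_zero one_ne_zero] at this
    exact absurd (this.trans_lt hfin) (lt_irrefl _)
  · rintro ⟨ρ, hρ, hfin, h⟩
    have := modulus_le_of_exceptional (Γ := {γ | ¬ P γ}) hp measurable_const hρ hfin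
      (ρ := fun _ => 0) fun γ hγ hrect hlt => absurd (h γ hrect hlt) hγ
    simpa [AlmostEveryCurve, ENNReal.zero_rpow_of_pos hp] using this

theorem AlmostEveryCurve.all {ι : Type*} [Countable ι] (hp : 0 < p) {P : ι → Curve X → Prop}
    (h : ∀ n, AlmostEveryCurve μ p (P n)) : AlmostEveryCurve μ p fun γ => ∀ n, P n γ := by
  refine le_antisymm (le_of_forall_gt fun ε hε => ?_) zero_le
  obtain ⟨δ, hδ, hsum⟩ := ENNReal.exists_pos_sum_of_countable' hε.ne' ι
  have h1 : ∀ n, ∃ ρ, Admissible {γ | ¬ P n γ} ρ ∧ ∫⁻ x, ρ x ^ p ∂μ < δ n :=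
    fun n => exists_admissible_of_modulus_lt ((h n).trans_lt (hδ n))
  choose ρ hadm hlt using h1
  have hA : Admissible {γ | ¬ ∀ n, P n γ} (fun x => ⨆ n, ρ n x) := by
    refine ⟨Measurable.iSup fun n => (hadm n).1, fun γ hγ hrect => ?_⟩
    obtain ⟨n, hn⟩ := not_forall.1 hγ
    exact ((hadm n).2 γ hn hrect).trans
      (Curve.integral_mono fun x => le_iSup (fun n => ρ n x) n)
  calc modulus μ p {γ | ¬ ∀ n, P n γ} ≤ ∫⁻ x, (⨆ n, ρ n x) ^ p ∂μ := modulus_le hA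
    _ ≤ ∫⁻ x, ∑' n, ρ n x ^ p ∂μ := lintegral_mono fun x => ENNReal.iSup_rpow_le_tsum hp _
    _ = ∑' n, ∫⁻ x, ρ n x ^ p ∂μ :=
        lintegral_tsum fun n => ((hadm n).1.pow_const p).aemeasurable
    _ ≤ ∑' n, δ n := ENNReal.tsum_le_tsum fun n => (hlt n).le
    _ < ε := hsum

theorem AlmostEveryCurve.mono {P Q : Curve X → Prop} (h : AlmostEveryCurve μ p P)
    (hPQ : ∀ γ, P γ → Q γ) : AlmostEveryCurve μ p Q := by
  refine le_antisymm (le_trans ?_ h.le) zero_le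
  exact le_iInf₂ fun ρ hρ => modulus_le ⟨hρ.1, fun γ hγ => hρ.2 γ (mt (hPQ γ) hγ)⟩

theorem AlmostEveryCurve.and (hp : 0 < p) {P Q : Curve X → Prop} (hP : AlmostEveryCurve μ p P)
    (hQ : AlmostEveryCurve μ p Q) : AlmostEveryCurve μ p fun γ => P γ ∧ Q γ := by
  refine (AlmostEveryCurve.all hp (P := fun n => if n = 0 then P else Q) fun n => ?_).mono
    fun γ h => ⟨by simpa using h 0, by simpa using h 1⟩
  split_ifs <;> assumption

theorem almostEveryCurve_integral_lt_top [BorelSpace X] (hp : 0 < p) {ρ : X → ℝ≥0∞}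
    (hρ : Measurable ρ) (hfin : ∫⁻ x, ρ x ^ p ∂μ < ∞) :
    AlmostEveryCurve μ p fun γ => γ.Rectifiable → γ.integral ρ < ∞ :=
  (almostEveryCurve_iff hp).2 ⟨ρ, hρ, hfin, fun _ _ h _ => h⟩

theorem modulus_le_of_almostEveryCurve [BorelSpace X] (hp : 0 < p) {Γ : Set (Curve X)}
    {ρ : X → ℝ≥0∞} (hρ : Measurable ρ)
    (h : AlmostEveryCurve μ p fun γ => γ ∈ Γ → γ.Rectifiable → 1 ≤ γ.integral ρ) :
    modulus μ p Γ ≤ ∫⁻ x, ρ x ^ p ∂μ := by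
  obtain ⟨ρ₀, hρ₀, hfin, h₀⟩ := (almostEveryCurve_iff hp).1 h
  exact modulus_le_of_exceptional hp hρ hρ₀ hfin fun γ hγ hr hlt => h₀ γ hr hlt hγ hr

theorem modulus_mono_of_almostEveryCurve [BorelSpace X] (hp : 0 < p) {Γ Γ' : Set (Curve X)}
    (h : AlmostEveryCurve μ p fun γ => γ ∈ Γ → γ.Rectifiable → γ ∈ Γ') :
    modulus μ p Γ ≤ modulus μ p Γ' :=
  le_iInf₂ fun _ hρ => modulus_le_of_almostEveryCurve hp hρ.1
    (h.mono fun γ hγ hΓ hr => hρ.2 γ (hγ hΓ hr) hr)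

end CurveModulus

/-! ### Quantitative uniform convexity of the `p`-th power. -/

section UniformConvexity

/-- This is the case `a = t`, `b = 1 - t` of the homogeneous inequality. By strict convexity the
convexity defect φ vanishes only at `t = 1/2`, where the left side ψ is negative. On the compact set
where `ψ ≥ 0` the defect thus has a positive minimum, and `ψ ≤ 1` makes its inverse a valid `C`. -/
theorem Real.exists_uniformConvexity_rpow_unit {p δ : ℝ} (hp : 1 < p) (hδ : 0 < δ) :
    ∃ C : ℝ, 0 ≤ C ∧ ∀ t ∈ Icc (0 : ℝ) 1, (max (2 * t - 1) 0) ^ p - δ * (t ^ p + (1 - t) ^ p) ≤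
      C * ((t ^ p + (1 - t) ^ p) / 2 - (1 / 2) ^ p) := by
  have hp0 : 0 < p := zero_lt_one.trans hp
  set φ : ℝ → ℝ := fun t => (t ^ p + (1 - t) ^ p) / 2 - (1 / 2) ^ p with hφ
  set ψ : ℝ → ℝ := fun t => (max (2 * t - 1) 0) ^ p - δ * (t ^ p + (1 - t) ^ p) with hψ
  have hrc : Continuous fun t : ℝ => t ^ p := Real.continuous_rpow_const hp0.le
  have h1c : Continuous fun t : ℝ => (1 - t) ^ p := hrc.comp (continuous_const.sub continuous_id)
  have h2c : Continuous fun t : ℝ => (max (2 * t - 1) 0) ^ p := hrc.comp (by fun_prop)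
  have hφc : Continuous φ := by fun_prop
  have hψc : Continuous ψ := by fun_prop
  have hφpos : ∀ t ∈ Icc (0 : ℝ) 1, t ≠ 1 / 2 → 0 < φ t := by
    intro t ht hne
    have := (strictConvexOn_rpow hp).2 (show t ∈ Ici 0 from ht.1)
      (show 1 - t ∈ Ici 0 from sub_nonneg.2 ht.2) (fun h => hne (by linarith))
      (one_half_pos (α := ℝ)) (one_half_pos (α := ℝ)) (add_halves 1)
    simp only [smul_eq_mul] at this
    rw [show (1 / 2 : ℝ) * t + 1 / 2 * (1 - t) = 1 / 2 by ring] at this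
    simp only [hφ]
    linarith
  have hφnn : ∀ t ∈ Icc (0 : ℝ) 1, 0 ≤ φ t := by
    intro t ht
    rcases eq_or_ne t (1 / 2) with rfl | h
    · simp only [hφ]; norm_num
    · exact (hφpos t ht h).le
  have hψle : ∀ t ∈ Icc (0 : ℝ) 1, ψ t ≤ 1 := by
    intro t ht
    have h1 : (max (2 * t - 1) 0) ^ p ≤ 1 :=
      Real.rpow_le_one (le_max_right _ _) (max_le (by linarith [ht.2]) zero_le_one) hp0.le
    have h2 : 0 ≤ t ^ p := Real.rpow_nonneg ht.1 p
    have h3 : 0 ≤ (1 - t) ^ p := Real.rpow_nonneg (sub_nonneg.2 ht.2) p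
    have : 0 ≤ δ * (t ^ p + (1 - t) ^ p) := by positivity
    simp only [hψ]
    linarith
  have hψhalf : ψ (1 / 2) < 0 := by
    have h2 : (0 : ℝ) < (1 / 2) ^ p := by positivity
    have : (1 - 1 / 2 : ℝ) = 1 / 2 := by norm_num
    simp only [hψ, this]
    rw [show max (2 * (1 / 2 : ℝ) - 1) 0 = 0 by norm_num, Real.zero_rpow hp0.ne']
    have : 0 < δ * ((1 / 2 : ℝ) ^ p + (1 / 2) ^ p) := by positivity
    linarith
  have hK : IsCompact (Icc (0 : ℝ) 1 ∩ ψ ⁻¹' Ici 0) :=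
    isCompact_Icc.inter_right (isClosed_Ici.preimage hψc)
  rcases (Icc (0 : ℝ) 1 ∩ ψ ⁻¹' Ici 0).eq_empty_or_nonempty with he | hne
  · refine ⟨0, le_rfl, fun t ht => ?_⟩
    rw [zero_mul]
    by_contra hcon
    exact (he ▸ (⟨ht, (not_le.1 hcon).le⟩ : t ∈ Icc (0 : ℝ) 1 ∩ ψ ⁻¹' Ici 0) : t ∈ (∅ : Set ℝ))
  · obtain ⟨t₀, ht₀, hmin⟩ := hK.exists_isMinOn hne hφc.continuousOn
    have hm : 0 < φ t₀ := hφpos t₀ ht₀.1 fun h => by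
      have := ht₀.2
      rw [h] at this
      exact absurd hψhalf (not_lt.2 this)
    refine ⟨(φ t₀)⁻¹, (inv_pos.2 hm).le, fun t ht => ?_⟩
    rcases lt_or_ge (ψ t) 0 with h | h
    · exact h.le.trans (mul_nonneg (inv_pos.2 hm).le (hφnn t ht))
    · refine (hψle t ht).trans ?_
      rw [inv_mul_eq_div, one_le_div hm]
      exact hmin ⟨ht, h⟩

/-- Both sides are homogeneous of degree `p`, so one may divide by `a + b`. Only the positive part
of `a - b` is estimated, which matches truncated subtraction in `ℝ≥0∞`. -/
theorem Real.exists_uniformConvexity_rpow {p δ : ℝ} (hp : 1 < p) (hδ : 0 < δ) :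
    ∃ C : ℝ, 0 ≤ C ∧ ∀ a b : ℝ, 0 ≤ a → 0 ≤ b →
      (max (a - b) 0) ^ p + C * ((a + b) / 2) ^ p ≤
        δ * (a ^ p + b ^ p) + C * ((a ^ p + b ^ p) / 2) := by
  have hp0 : 0 < p := zero_lt_one.trans hp
  obtain ⟨C, hC, h⟩ := Real.exists_uniformConvexity_rpow_unit hp hδ
  refine ⟨C, hC, fun a b ha hb => ?_⟩
  rcases (add_nonneg ha hb).eq_or_lt with h0 | hs
  · obtain rfl : a = 0 := by linarith
    obtain rfl : b = 0 := by linarith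
    simp [Real.zero_rpow hp0.ne']
  · set s := a + b with hsdef
    have ht : a / s ∈ Icc (0 : ℝ) 1 := ⟨by positivity, (div_le_one hs).2 (by linarith)⟩
    have e1 : a = s * (a / s) := by field_simp
    have e2 : b = s * (1 - a / s) := by field_simp; linarith
    have e3 : max (a - b) 0 = s * max (2 * (a / s) - 1) 0 := by
      rw [mul_max_of_nonneg _ _ hs.le, mul_zero]
      congr 1
      field_simp
      linarith
    have r1 : a ^ p = s ^ p * (a / s) ^ p := by
      rw [← Real.mul_rpow hs.le ht.1, ← e1]
    have r2 : b ^ p = s ^ p * (1 - a / s) ^ p := by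
      rw [← Real.mul_rpow hs.le (sub_nonneg.2 ht.2), ← e2]
    have r3 : (max (a - b) 0) ^ p = s ^ p * (max (2 * (a / s) - 1) 0) ^ p := by
      rw [← Real.mul_rpow hs.le (le_max_right _ _), ← e3]
    have r4 : (s / 2) ^ p = s ^ p * (1 / 2) ^ p := by
      rw [← Real.mul_rpow hs.le (by norm_num)]; ring_nf
    rw [r3, r1, r2, r4]
    have := mul_le_mul_of_nonneg_left (h _ ht) (Real.rpow_nonneg hs.le p)
    linarith

theorem ENNReal.exists_uniformConvexity_rpow {p : ℝ} (hp : 1 < p) {δ : ℝ≥0∞} (hδ : δ ≠ 0)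
    (hδ' : δ ≠ ∞) :
    ∃ C : ℝ≥0∞, C ≠ ∞ ∧ ∀ a b : ℝ≥0∞, (a - b) ^ p + C * ((a + b) / 2) ^ p ≤
      δ * (a ^ p + b ^ p) + C * ((a ^ p + b ^ p) / 2) := by
  have hp0 : 0 < p := zero_lt_one.trans hp
  obtain ⟨C, hC, h⟩ := Real.exists_uniformConvexity_rpow hp (ENNReal.toReal_pos hδ hδ')
  refine ⟨ENNReal.ofReal C, ENNReal.ofReal_ne_top, fun a b => ?_⟩
  rcases eq_or_ne a ∞ with rfl | ha
  · simp [ENNReal.top_rpow_of_pos hp0, ENNReal.mul_top hδ]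
  rcases eq_or_ne b ∞ with rfl | hb
  · simp [ENNReal.top_rpow_of_pos hp0, ENNReal.mul_top hδ]
  lift a to NNReal using ha
  lift b to NNReal using hb
  lift δ to NNReal using hδ'
  lift C to NNReal using hC
  have := h a b a.2 b.2
  rw [ENNReal.ofReal_coe_nnreal, ← ENNReal.coe_sub, ← ENNReal.coe_add, ← ENNReal.coe_ofNat,
    ← ENNReal.coe_div two_ne_zero, ← ENNReal.coe_rpow_of_nonneg _ hp0.le,
    ← ENNReal.coe_rpow_of_nonneg _ hp0.le, ← ENNReal.coe_rpow_of_nonneg _ hp0.le,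
    ← ENNReal.coe_rpow_of_nonneg _ hp0.le, ← ENNReal.coe_add, ← ENNReal.coe_div two_ne_zero]
  exact_mod_cast this

end UniformConvexity

/-! ### Rapidly converging near-minimizers in decreasing midpoint convex classes. -/

section Selection

variable {α : Type*} [MeasurableSpace α] {μ : Measure α} {p : ℝ}

/-- Nonnegative functions whose midpoints have nearly the same `L^p` norms are close in `L^p`. -/
theorem lintegral_sub_rpow_le_of_midpoint (hp : 1 < p) {D η : ℝ≥0∞} (hD : D ≠ ∞) (hη : η ≠ 0)
    {A : ℕ → ℝ≥0∞} (hA : Tendsto A atTop (𝓝 D)) {h : ℕ → α → ℝ≥0∞} (hm : ∀ n, Measurable (h n))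
    {e : ℕ → ℝ≥0∞} (he : Tendsto e atTop (𝓝 0))
    (hle : ∀ n m, n ≤ m → ∫⁻ x, h m x ^ p ∂μ ≤ D + e n)
    (hmid : ∀ n m, n ≤ m → A n ≤ ∫⁻ x, ((h n x + h m x) / 2) ^ p ∂μ) :
    ∀ᶠ n in atTop, ∀ m, n ≤ m → ∫⁻ x, (h n x - h m x) ^ p ∂μ ≤ η := by
  wlog hηtop : η ≠ ∞ generalizing η
  · filter_upwards [this one_ne_zero ENNReal.one_ne_top] with n hn m hnm
    rw [not_not.1 hηtop]
    exact le_top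
  have hD1 : D + 1 ≠ ∞ := ENNReal.add_ne_top.2 ⟨hD, ENNReal.one_ne_top⟩
  have hD2 : 2 * (D + 1) ≠ ∞ := ENNReal.mul_ne_top ENNReal.ofNat_ne_top hD1
  have hD0 : 2 * (D + 1) ≠ 0 := by simp
  obtain ⟨C, hC, hconv⟩ := ENNReal.exists_uniformConvexity_rpow hp
    (δ := η / 2 / (2 * (D + 1)))
    (ENNReal.div_ne_zero.2 ⟨ENNReal.div_ne_zero.2 ⟨hη, ENNReal.ofNat_ne_top⟩, hD2⟩)
    (ENNReal.div_ne_top (ENNReal.div_ne_top hηtop two_ne_zero) hD0)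
  -- Eventually the two `p`-th power integrals add up to at most `2 * (D + 1)`, so the δ-term of the
  -- convexity inequality costs at most `η / 2`.
  set δ := η / 2 / (2 * (D + 1))
  have hδ : δ * (2 * (D + 1)) = η / 2 := ENNReal.div_mul_cancel hD0 hD2
  -- This is the remaining convexity defect: endpoint integrals are at most `D + e n`, midpoint
  -- integrals at least `A n`, and both bounds tend to `D`.
  have hlim : Tendsto (fun n => C * (D + e n) - C * A n) atTop (𝓝 (C * (D + 0) - C * D)) :=
    ENNReal.Tendsto.sub (ENNReal.Tendsto.const_mul (tendsto_const_nhds.add he) (Or.inr hC))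
      (ENNReal.Tendsto.const_mul hA (Or.inr hC)) (Or.inr (ENNReal.mul_ne_top hC hD))
  rw [add_zero, tsub_self] at hlim
  have hη2 : 0 < η / 2 := ENNReal.half_pos hη
  filter_upwards [hlim.eventually (gt_mem_nhds hη2), he.eventually (gt_mem_nhds one_pos),
    hA.eventually_ne hD] with n hn1 hn2 hAn m hnm
  have hi := hle n n le_rfl
  have hj := hle n m hnm
  have hd : Measurable fun x => h n x - h m x := (hm n).sub (hm m)
  have key : ∫⁻ x, (h n x - h m x) ^ p ∂μ + C * A n ≤ η / 2 + C * (D + e n) := by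
    calc ∫⁻ x, (h n x - h m x) ^ p ∂μ + C * A n
        ≤ ∫⁻ x, (h n x - h m x) ^ p ∂μ + C * ∫⁻ x, ((h n x + h m x) / 2) ^ p ∂μ := by
          gcongr; exact hmid n m hnm
      _ = ∫⁻ x, ((h n x - h m x) ^ p + C * ((h n x + h m x) / 2) ^ p) ∂μ := by
          rw [lintegral_add_left (hd.pow_const p), lintegral_const_mul' _ _ hC]
      _ ≤ ∫⁻ x, (δ * (h n x ^ p + h m x ^ p) + C * ((h n x ^ p + h m x ^ p) / 2)) ∂μ :=
          lintegral_mono fun x => hconv _ _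
      _ = ∫⁻ x, (δ + C / 2) * (h n x ^ p + h m x ^ p) ∂μ := by
          refine lintegral_congr fun x => ?_
          simp only [div_eq_mul_inv]; ring
      _ = (δ + C / 2) * (∫⁻ x, h n x ^ p ∂μ + ∫⁻ x, h m x ^ p ∂μ) := by
          rw [lintegral_const_mul _ 
              (show Measurable fun x => h n x ^ p + h m x ^ p from
                ((hm n).pow_const p).add ((hm m).pow_const p)),
            lintegral_add_left ((hm n).pow_const p)]
      _ ≤ (δ + C / 2) * (2 * (D + e n)) := by
          rw [two_mul]; gcongr
      _ = δ * (2 * (D + e n)) + C * (D + e n) := by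
          rw [add_mul, ← mul_assoc (C / 2), ENNReal.div_mul_cancel two_ne_zero ENNReal.ofNat_ne_top]
      _ ≤ η / 2 + C * (D + e n) := by
          rw [← hδ]; gcongr
  calc ∫⁻ x, (h n x - h m x) ^ p ∂μ
      ≤ η / 2 + C * (D + e n) - C * A n :=
        ENNReal.le_sub_of_add_le_right (ENNReal.mul_ne_top hC hAn) key
    _ ≤ η / 2 + (C * (D + e n) - C * A n) := add_tsub_le_assoc
    _ ≤ η / 2 + η / 2 := by gcongr
    _ = η := ENNReal.add_halves η

/-- From decreasing midpoint convex classes of nonnegative functions with bounded infima of the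
`L^p` norms one can select a sequence that converges fast enough in `L^p`. -/
theorem exists_selection_of_midpoint_mem (hp : 1 < p) {𝒞 : ℕ → Set (α → ℝ≥0∞)} (hanti : Antitone 𝒞)
    (hmeas : ∀ n, ∀ f ∈ 𝒞 n, Measurable f)
    (hmid : ∀ n, ∀ f ∈ 𝒞 n, ∀ g ∈ 𝒞 n, (fun x => (f x + g x) / 2) ∈ 𝒞 n)
    {M : ℝ≥0∞} (hM : M ≠ ∞) (hex : ∀ n, ∀ M' > M, ∃ f ∈ 𝒞 n, ∫⁻ x, f x ^ p ∂μ < M') :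
    ∃ (H a : ℕ → α → ℝ≥0∞) (h : α → ℝ≥0∞), (∀ n, H n ∈ 𝒞 n) ∧ (∀ n, Measurable (a n)) ∧
      Measurable h ∧ ∫⁻ x, h x ^ p ∂μ ≤ M ∧ ∫⁻ x, (∑' n, a n x) ^ p ∂μ < ∞ ∧
      ∀ n x, H n x ≤ h x + ∑' j, a (j + n) x := by
  have hp0 : 0 < p := zero_lt_one.trans hp
  -- The infima increase because the classes shrink, and they are bounded by `M`, so they converge
  -- to a finite `D`. A midpoint of elements of classes `n ≤ m` lies in class `n`, which bounds its
  -- integral below by `A n`.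
  set A : ℕ → ℝ≥0∞ := fun n => ⨅ f ∈ 𝒞 n, ∫⁻ x, f x ^ p ∂μ with hAdef
  have hAM : ∀ n, A n ≤ M := fun n => le_of_forall_gt fun M' hM' => by
    obtain ⟨f, hf, hlt⟩ := hex n M' hM'
    exact (iInf₂_le f hf).trans_lt hlt
  have hAmono : Monotone A := fun n m hnm => biInf_mono fun f hf => hanti hnm hf
  have hDM : ⨆ n, A n ≤ M := iSup_le hAM
  have hlimA := tendsto_atTop_iSup hAmono
  set D := ⨆ n, A n with hDdef
  have hD : D ≠ ∞ := ne_top_of_le_ne_top hM hDM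
  set e : ℕ → ℝ≥0∞ := fun n => ((n + 1 : ℕ) : ℝ≥0∞)⁻¹ with hedef
  have he : Tendsto e atTop (𝓝 0) :=
    ENNReal.tendsto_inv_nat_nhds_zero.comp (tendsto_add_atTop_nat 1)
  have hexh : ∀ n, ∃ f ∈ 𝒞 n, ∫⁻ x, f x ^ p ∂μ < A n + e n := fun n => by
    have hlt : A n < A n + e n := ENNReal.lt_add_right (ne_top_of_le_ne_top hM (hAM n))
      (ENNReal.inv_ne_zero.2 (ENNReal.natCast_ne_top _))
    simpa [hAdef, iInf_lt_iff] using hlt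
  choose h h𝒞 hlt using hexh
  have hle : ∀ n m, n ≤ m → ∫⁻ x, h m x ^ p ∂μ ≤ D + e n := fun n m hnm =>
    (hlt m).le.trans (add_le_add (le_iSup A m)
      (ENNReal.inv_le_inv.2 (Nat.cast_le.2 (Nat.succ_le_succ hnm))))
  obtain ⟨φ, hφ, hφ'⟩ := extraction_forall_of_eventually fun k =>
    lintegral_sub_rpow_le_of_midpoint (μ := μ) hp hD (summabilityWeight_pos hp0 k).ne' hlimA
      (fun n => hmeas n _ (h𝒞 n)) he hle
      fun n m hnm => iInf₂_le _ (hmid n _ (h𝒞 n) _ (hanti hnm (h𝒞 m)))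
  have hHm : ∀ n, Measurable (h (φ n)) := fun n => hmeas _ _ (h𝒞 _)
  have ham : ∀ n, Measurable fun x => h (φ n) x - h (φ (n + 1)) x := fun n =>
    (hHm n).sub (hHm (n + 1))
  -- Taking the lower limit as `h` lets Fatou's lemma bound its norm. Truncated differences suffice,
  -- since only an upper bound of `H n` by the limit plus a tail is needed.
  refine ⟨fun n => h (φ n), fun n x => h (φ n) x - h (φ (n + 1)) x,
    fun x => liminf (fun n => h (φ n) x) atTop, fun n => hanti hφ.le_apply (h𝒞 (φ n)), ham,
    Measurable.liminf hHm, ?_, lintegral_tsum_rpow_lt_top hp0 ham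
      fun n => hφ' n _ (hφ n.lt_succ_self).le, fun n x => ?_⟩
  · have hpow : ∀ x, liminf (fun n => h (φ n) x) atTop ^ p =
        liminf (fun n => h (φ n) x ^ p) atTop := fun x =>
      (ENNReal.orderIsoRpow p hp0).liminf_apply
    simp_rw [hpow]
    calc ∫⁻ x, liminf (fun n => h (φ n) x ^ p) atTop ∂μ
        ≤ liminf (fun n => ∫⁻ x, h (φ n) x ^ p ∂μ) atTop :=
          lintegral_liminf_le fun n => (hHm n).pow_const p
      _ ≤ liminf (fun n => D + e (φ n)) atTop :=
          liminf_le_liminf (Eventually.of_forall fun n => hle _ _ le_rfl)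
      _ = D := by
          have := (he.comp hφ.tendsto_atTop).const_add D
          rw [add_zero] at this
          exact this.liminf_eq
      _ ≤ M := hDM
  · rw [← tsub_le_iff_right]
    refine le_liminf_of_le (by isBoundedDefault) ?_
    filter_upwards [eventually_ge_atTop n] with m hnm
    rw [tsub_le_iff_right]
    obtain ⟨k, rfl⟩ := Nat.exists_eq_add_of_le hnm
    -- Telescoping, by means of `a ≤ b + (a - b)` for truncated subtraction.
    have hk : ∀ k, h (φ n) x ≤ h (φ (n + k)) x +
        ∑ j ∈ Finset.range k, (h (φ (j + n)) x - h (φ (j + n + 1)) x) := by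
      intro k
      induction k with
      | zero => simp
      | succ k ih =>
        refine ih.trans ?_
        rw [Finset.sum_range_succ, ← add_assoc, add_right_comm]
        gcongr
        rw [add_comm k n, ← add_assoc]
        exact le_add_tsub
    exact (hk k).trans (by gcongr; exact ENNReal.sum_le_tsum _)

end Selection

/-! ### Metric-valued functions on an interval controlled by integrals. -/

section Interval

variable {Z : Type*} [MetricSpace Z]

theorem integrableOn_toReal_and_lintegral_eq {h : ℝ → ℝ≥0∞} (hm : Measurable h) {x y : ℝ}
    (hxy : x ≤ y) (hfin : ∫⁻ t in Icc x y, h t < ∞) :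
    IntegrableOn (fun t => (h t).toReal) (Icc x y) ∧
      ∫⁻ t in Icc x y, h t = ENNReal.ofReal (∫ t in x..y, (h t).toReal) := by
  have hae : ∀ᵐ t ∂volume.restrict (Icc x y), h t < ∞ := ae_lt_top hm hfin.ne
  refine ⟨integrable_toReal_of_lintegral_ne_top hm.aemeasurable hfin.ne, ?_⟩
  rw [intervalIntegral.integral_of_le hxy, ← integral_Icc_eq_integral_Ioc,
    integral_toReal hm.aemeasurable hae, ENNReal.ofReal_toReal hfin.ne]

/-- If small integrals control small distances, then all distances are controlled by integrals, up
to a single small error. -/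
theorem edist_le_lintegral_add_of_lt {f : ℝ → Z} {h : ℝ → ℝ≥0∞} (hm : Measurable h) {l ε : ℝ}
    (hl : 0 ≤ l) (hε : 0 < ε) (hfin : ∫⁻ t in Icc 0 l, h t < ∞)
    (hf : ∀ x y, 0 ≤ x → x ≤ y → y ≤ l → ∫⁻ t in Icc x y, h t < ENNReal.ofReal ε →
      dist (f x) (f y) < ε) :
    edist (f 0) (f l) ≤ (∫⁻ t in Icc 0 l, h t) + ENNReal.ofReal ε := by
  have hsub : ∀ x y, 0 ≤ x → x ≤ y → y ≤ l →
      ∫⁻ t in Icc x y, h t = ENNReal.ofReal (∫ t in x..y, (h t).toReal) := fun x y hx hxy hy =>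
    (integrableOn_toReal_and_lintegral_eq hm hxy
      ((lintegral_mono_set (Icc_subset_Icc hx hy)).trans_lt hfin)).2
  have hint := (integrableOn_toReal_and_lintegral_eq hm hl hfin).1
  have hii : ∀ x y, 0 ≤ x → x ≤ y → y ≤ l →
      IntervalIntegrable (fun t => (h t).toReal) volume x y := fun x y hx hxy hy => by
    rw [intervalIntegrable_iff_integrableOn_Icc_of_le hxy]
    exact hint.mono_set (Icc_subset_Icc hx hy)
  set F : ℝ → ℝ := fun x => ∫ t in (0 : ℝ)..x, (h t).toReal with hF
  have hF0 : F 0 = 0 := intervalIntegral.integral_same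
  have hFc : ContinuousOn F (Icc 0 l) := by
    have := intervalIntegral.continuousOn_primitive_interval (a := 0) (b := l)
      (f := fun t => (h t).toReal) (μ := volume) (by rwa [uIcc_of_le hl])
    rwa [uIcc_of_le hl] at this
  have hFsub : ∀ x y, 0 ≤ x → x ≤ y → y ≤ l → ∫ t in x..y, (h t).toReal = F y - F x := by
    intro x y hx hxy hy
    exact eq_sub_of_add_eq' (intervalIntegral.integral_add_adjacent_intervals
      (hii 0 x le_rfl hx (hxy.trans hy)) (hii x y hx hxy hy))
  have hFnn : ∀ x, 0 ≤ x → 0 ≤ F x := fun x hx =>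
    intervalIntegral.integral_nonneg hx fun t _ => ENNReal.toReal_nonneg
  have hdist : ∀ x y, 0 ≤ x → x ≤ y → y ≤ l → F y - F x < ε → dist (f x) (f y) < ε := by
    intro x y hx hxy hy hlt
    refine hf x y hx hxy hy ?_
    rw [hsub x y hx hxy hy, hFsub x y hx hxy hy]
    exact (ENNReal.ofReal_lt_ofReal_iff hε).2 hlt
  have hchain : ∀ n : ℕ, ∀ x, 0 ≤ x → x ≤ l → F x < (n + 1) * ε →
      dist (f 0) (f x) ≤ (n + 1) * ε := by
    intro n
    induction n with
    | zero =>
      intro x hx hxl hlt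
      simp only [Nat.cast_zero, zero_add, one_mul] at hlt ⊢
      exact (hdist 0 x le_rfl hx hxl (by rwa [hF0, sub_zero])).le
    | succ n ih =>
      intro x hx hxl hlt
      push_cast at hlt ⊢
      have hn : (0 : ℝ) < n + 1 := by positivity
      have hn2 : (0 : ℝ) < n + 1 + 1 := by positivity
      -- Cut where the primitive reaches the fraction $(n+1)/(n+2)$ of `F x`: the last piece then
      -- has integral $F(x)/(n+2) < \epsilon$, and the first part is covered by induction.
      have hmem : F x * ((n + 1) / (n + 1 + 1)) ∈ Icc (F 0) (F x) := by
        rw [hF0]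
        refine ⟨mul_nonneg (hFnn x hx) (by positivity), ?_⟩
        exact mul_le_of_le_one_right (hFnn x hx) ((div_le_one hn2).2 (by linarith))
      obtain ⟨y, hy, hyF⟩ := intermediate_value_Icc hx (hFc.mono (Icc_subset_Icc le_rfl hxl)) hmem
      have h1 : F x / (n + 1 + 1) < ε := by rw [div_lt_iff₀ hn2]; linarith
      have h2 : F y = (n + 1) * (F x / (n + 1 + 1)) := by rw [hyF]; ring
      have h3 : F x - F y = F x / (n + 1 + 1) := by rw [hyF]; field_simp; ring
      have h4 := ih y hy.1 (hy.2.trans hxl) (by rw [h2]; gcongr)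
      have h5 := hdist y x hy.1 hy.2 hxl (by rwa [h3])
      linarith [dist_triangle (f 0) (f y) (f x)]
  have hfl : ⌊F l / ε⌋₊ * ε ≤ F l := by
    rw [← le_div_iff₀ hε]; exact Nat.floor_le (div_nonneg (hFnn l hl) hε.le)
  -- With this number of cuts the bound is $(\lfloor F(l)/\epsilon\rfloor + 1)\epsilon \le F(l) +
  -- \epsilon$.
  have hmain := hchain ⌊F l / ε⌋₊ l hl le_rfl (by
    rw [← div_lt_iff₀ hε]; exact Nat.lt_floor_add_one _)
  rw [hsub 0 l le_rfl hl le_rfl, ← ENNReal.ofReal_add (hFnn l hl) hε.le, edist_dist]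
  exact ENNReal.ofReal_le_ofReal (by linarith)

/-- A function controlled by the integrals of two densities is controlled by the integral of the
smaller one. -/
theorem dist_le_integral_min {f : ℝ → Z} {H₁ H₂ : ℝ → ℝ} {l : ℝ} (hl : 0 ≤ l)
    (h₁ : IntervalIntegrable H₁ volume 0 l) (h₂ : IntervalIntegrable H₂ volume 0 l)
    (hf₁ : ∀ x y, 0 ≤ x → x ≤ y → y ≤ l → dist (f x) (f y) ≤ ∫ t in x..y, H₁ t)
    (hf₂ : ∀ x y, 0 ≤ x → x ≤ y → y ≤ l → dist (f x) (f y) ≤ ∫ t in x..y, H₂ t) :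
    dist (f 0) (f l) ≤ ∫ t in (0 : ℝ)..l, min (H₁ t) (H₂ t) := by
  -- The distance to `f 0` is real valued, so it can be differentiated almost everywhere although
  -- `Z` is only a metric space. It is absolutely continuous because the primitive of `H₁` dominates
  -- its increments.
  set φ : ℝ → ℝ := fun t => dist (f 0) (f t) with hφ
  have hφle : ∀ x y, |φ y - φ x| ≤ dist (f x) (f y) := fun x y => by
    rw [hφ, dist_comm (f x)]
    simpa [Real.dist_eq] using dist_dist_dist_le_right (f 0) (f y) (f x)
  have hsub : ∀ {H : ℝ → ℝ}, IntervalIntegrable H volume 0 l → ∀ x y, 0 ≤ x → x ≤ y → y ≤ l →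
      ∫ t in x..y, H t = (∫ t in (0 : ℝ)..y, H t) - ∫ t in (0 : ℝ)..x, H t := by
    intro H hH x y hx hxy hy
    rw [intervalIntegral.integral_interval_sub_left]
    · refine hH.mono_set ?_
      rw [uIcc_of_le hl, uIcc_of_le (hx.trans hxy)]
      exact Icc_subset_Icc le_rfl hy
    · refine hH.mono_set ?_
      rw [uIcc_of_le hl, uIcc_of_le hx]
      exact Icc_subset_Icc le_rfl (hxy.trans hy)
  have hac : AbsolutelyContinuousOnInterval φ 0 l := by
    have hG := h₁.absolutelyContinuousOnInterval_intervalIntegral (c := 0) (by simp)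
    rw [absolutelyContinuousOnInterval_iff] at hG ⊢
    intro ε hε
    obtain ⟨δ, hδ, h⟩ := hG ε hε
    refine ⟨δ, hδ, fun E hE hlt => (Finset.sum_le_sum fun i hi => ?_).trans_lt (h E hE hlt)⟩
    have hmem := hE.1 i hi
    rw [uIcc_of_le hl] at hmem
    have key : ∀ x y, x ∈ Icc 0 l → y ∈ Icc 0 l → x ≤ y →
        dist (φ x) (φ y) ≤ dist (∫ t in (0 : ℝ)..x, H₁ t) (∫ t in (0 : ℝ)..y, H₁ t) := by
      intro x y hx hy hxy
      rw [dist_comm, Real.dist_eq, dist_comm, Real.dist_eq, ← hsub h₁ x y hx.1 hxy hy.2]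
      exact (hφle x y).trans ((hf₁ x y hx.1 hxy hy.2).trans (le_abs_self _))
    rcases le_total (E.2 i).1 (E.2 i).2 with hxy | hxy
    · exact key _ _ hmem.1 hmem.2 hxy
    · rw [dist_comm, dist_comm (∫ t in (0 : ℝ)..(E.2 i).1, H₁ t)]
      exact key _ _ hmem.2 hmem.1 hxy
  have hder : ∀ {H : ℝ → ℝ}, IntervalIntegrable H volume 0 l →
      (∀ x y, 0 ≤ x → x ≤ y → y ≤ l → dist (f x) (f y) ≤ ∫ t in x..y, H t) →
      ∀ᵐ t, t ∈ Ioo 0 l → deriv φ t ≤ H t := by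
    intro H hH hf
    filter_upwards [hH.ae_hasDerivAt_integral, hac.ae_differentiableAt] with t ht1 ht2 ht
    have htI : t ∈ uIcc 0 l := by rw [uIcc_of_le hl]; exact Ioo_subset_Icc_self ht
    have hd := (ht1 htI 0 (by simp)).sub (ht2 htI).hasDerivAt
    -- The hypothesis on `f` says that the primitive grows at least as fast as φ; monotonicity of
    -- the difference gives `deriv φ ≤ H` almost everywhere.
    have hmono : MonotoneOn ((fun x => ∫ t in (0 : ℝ)..x, H t) - φ) (Ioo 0 l) := by
      intro x hx y hy hxy
      have h1 := hf x y hx.1.le hxy hy.2.le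
      rw [hsub hH x y hx.1.le hxy hy.2.le] at h1
      have h2 := (le_abs_self _).trans (hφle x y)
      simp only [Pi.sub_apply]
      linarith
    have hacc := uniqueDiffWithinAt_iff_accPt.1 (uniqueDiffOn_Ioo 0 l t ht)
    linarith [hd.hasDerivWithinAt.nonneg_of_monotoneOn hacc hmono]
  have h0 : dist (f 0) (f l) = φ l - φ 0 := by simp [hφ]
  rw [h0, ← hac.integral_deriv_eq_sub, intervalIntegral.integral_of_le hl,
    intervalIntegral.integral_of_le hl, integral_Ioc_eq_integral_Ioo,
    integral_Ioc_eq_integral_Ioo]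
  have hIoo : ∀ {H : ℝ → ℝ}, IntervalIntegrable H volume 0 l → IntegrableOn H (Ioo 0 l) := by
    intro H hH
    rw [intervalIntegrable_iff_integrableOn_Ioo_of_le hl] at hH
    exact hH
  refine integral_mono_ae (hIoo hac.intervalIntegrable_deriv) ((hIoo h₁).inf (hIoo h₂)) ?_
  rw [EventuallyLE, ae_restrict_iff' measurableSet_Ioo]
  filter_upwards [hder h₁ hf₁, hder h₂ hf₂] with t ht₁ ht₂ ht
  exact le_min (ht₁ ht) (ht₂ ht)

theorem edist_le_lintegral_min {f : ℝ → Z} {h₁ h₂ : ℝ → ℝ≥0∞} (hm₁ : Measurable h₁)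
    (hm₂ : Measurable h₂) {l : ℝ} (hl : 0 ≤ l) (hfin₁ : ∫⁻ t in Icc 0 l, h₁ t < ∞)
    (hfin₂ : ∫⁻ t in Icc 0 l, h₂ t < ∞)
    (hf₁ : ∀ x y, 0 ≤ x → x ≤ y → y ≤ l → edist (f x) (f y) ≤ ∫⁻ t in Icc x y, h₁ t)
    (hf₂ : ∀ x y, 0 ≤ x → x ≤ y → y ≤ l → edist (f x) (f y) ≤ ∫⁻ t in Icc x y, h₂ t) :
    edist (f 0) (f l) ≤ ∫⁻ t in Icc 0 l, min (h₁ t) (h₂ t) := by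
  have hconv : ∀ {h : ℝ → ℝ≥0∞}, Measurable h → ∫⁻ t in Icc 0 l, h t < ∞ →
      (∀ x y, 0 ≤ x → x ≤ y → y ≤ l → edist (f x) (f y) ≤ ∫⁻ t in Icc x y, h t) →
      ∀ x y, 0 ≤ x → x ≤ y → y ≤ l → dist (f x) (f y) ≤ ∫ t in x..y, (h t).toReal := by
    intro h hm hfin hf x y hx hxy hy
    have h1 := hf x y hx hxy hy
    rw [(integrableOn_toReal_and_lintegral_eq hm hxy
      ((lintegral_mono_set (Icc_subset_Icc hx hy)).trans_lt hfin)).2, edist_dist] at h1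
    exact (ENNReal.ofReal_le_ofReal_iff
      (intervalIntegral.integral_nonneg hxy fun t _ => ENNReal.toReal_nonneg)).1 h1
  have hii : ∀ {h : ℝ → ℝ≥0∞}, Measurable h → ∫⁻ t in Icc 0 l, h t < ∞ →
      IntervalIntegrable (fun t => (h t).toReal) volume 0 l := fun hm hfin => by
    rw [intervalIntegrable_iff_integrableOn_Icc_of_le hl]
    exact (integrableOn_toReal_and_lintegral_eq hm hl hfin).1
  have hfin : ∫⁻ t in Icc 0 l, min (h₁ t) (h₂ t) < ∞ :=
    (lintegral_mono fun t => min_le_left _ _).trans_lt hfin₁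
  rw [(integrableOn_toReal_and_lintegral_eq (hm₁.min hm₂) hl hfin).2, edist_dist]
  refine ENNReal.ofReal_le_ofReal ((dist_le_integral_min hl (hii hm₁ hfin₁) (hii hm₂ hfin₂)
    (hconv hm₁ hfin₁ hf₁) (hconv hm₂ hfin₂ hf₂)).trans_eq ?_)
  rw [intervalIntegral.integral_of_le hl, intervalIntegral.integral_of_le hl,
    ← integral_Icc_eq_integral_Ioc, ← integral_Icc_eq_integral_Ioc]
  refine integral_congr_ae ?_
  filter_upwards [ae_lt_top hm₁ hfin₁.ne, ae_lt_top hm₂ hfin₂.ne] with t ht₁ ht₂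
  exact (ENNReal.toReal_min ht₁.ne ht₂.ne).symm

/-- A function whose oscillation is controlled by the integrals of a density is continuous. -/
theorem continuousOn_of_edist_le_lintegral {f : ℝ → Z} {h : ℝ → ℝ≥0∞} (hm : Measurable h) {l : ℝ}
    (hl : 0 ≤ l) (hfin : ∫⁻ t in Icc 0 l, h t < ∞)
    (hf : ∀ x y, 0 ≤ x → x ≤ y → y ≤ l → edist (f x) (f y) ≤ ∫⁻ t in Icc x y, h t) :
    ContinuousOn f (Icc 0 l) := by
  have hint := (integrableOn_toReal_and_lintegral_eq hm hl hfin).1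
  set F : ℝ → ℝ := fun x => ∫ t in (0 : ℝ)..x, (h t).toReal with hF
  have hFc : ContinuousOn F (Icc 0 l) := by
    have := intervalIntegral.continuousOn_primitive_interval (a := 0) (b := l)
      (f := fun t => (h t).toReal) (μ := volume) (by rwa [uIcc_of_le hl])
    rwa [uIcc_of_le hl] at this
  have hii : ∀ x y, 0 ≤ x → x ≤ y → y ≤ l →
      IntervalIntegrable (fun t => (h t).toReal) volume x y := fun x y hx hxy hy => by
    rw [intervalIntegrable_iff_integrableOn_Icc_of_le hxy]
    exact hint.mono_set (Icc_subset_Icc hx hy)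
  have key : ∀ x ∈ Icc 0 l, ∀ y ∈ Icc 0 l, dist (f x) (f y) ≤ dist (F x) (F y) := by
    intro x hx y hy
    wlog hxy : x ≤ y generalizing x y
    · rw [dist_comm, dist_comm (F x)]
      exact this y hy x hx (not_le.1 hxy).le
    have h1 := hf x y hx.1 hxy hy.2
    rw [(integrableOn_toReal_and_lintegral_eq hm hxy
      ((lintegral_mono_set (Icc_subset_Icc hx.1 hy.2)).trans_lt hfin)).2, edist_dist] at h1
    have h2 := (ENNReal.ofReal_le_ofReal_iff
      (intervalIntegral.integral_nonneg hxy fun t _ => ENNReal.toReal_nonneg)).1 h1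
    have h3 : ∫ t in x..y, (h t).toReal = F y - F x :=
      eq_sub_of_add_eq' (intervalIntegral.integral_add_adjacent_intervals
        (hii 0 x le_rfl hx.1 hx.2) (hii x y hx.1 hxy hy.2))
    rw [h3] at h2
    rw [dist_comm (F x), Real.dist_eq]
    exact h2.trans (le_abs_self _)
  rw [Metric.continuousOn_iff] at hFc ⊢
  intro b hb ε hε
  obtain ⟨δ, hδ, h⟩ := hFc b hb ε hε
  exact ⟨δ, hδ, fun a ha hab => (key a ha b hb).trans_lt (h a ha hab)⟩

end Interval

/-! ### Weak upper gradients along almost every curve. -/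

namespace CurveModulus

variable {X Z : Type*} [MetricSpace X] [MeasurableSpace X] [BorelSpace X] [MetricSpace Z]
  {μ : Measure X} {p : ℝ} {u : X → Z}

/-- A property of almost every curve holds on almost every curve together with all its arcs. -/
theorem AlmostEveryCurve.arc (hp : 0 < p) {P : Curve X → Prop} (h : AlmostEveryCurve μ p P) :
    AlmostEveryCurve μ p fun γ => ∀ (c : ℝ → X) (hc : Continuous c) (l : ℝ),
      HasUnitSpeedOn c (Icc 0 l) → (∀ ρ : X → ℝ≥0∞, γ.integral ρ = ∫⁻ t in Icc 0 l, ρ (c t)) →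
      ∀ x y (hxy : x ≤ y), 0 ≤ x → y ≤ l → P (Curve.arc c hc x y hxy) := by
  -- One `ρ` serves all arcs at once: a finite integral along the curve forces finite integrals
  -- along its arcs. Hence uncountably many arcs cause no difficulty.
  obtain ⟨ρ, hρ, hfin, hP⟩ := (almostEveryCurve_iff hp).1 h
  refine (almostEveryCurve_iff hp).2 ⟨ρ, hρ, hfin, fun γ _ hlt c hc l hs hint x y hxy hx hy => ?_⟩
  have hs' := hs.mono hx hy
  refine hP _ (Curve.rectifiable_arc hc hxy hs') ?_
  rw [Curve.integral_arc hc hxy hs']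
  rw [hint] at hlt
  exact (lintegral_mono_set (Icc_subset_Icc hx hy)).trans_lt hlt

theorem IsWeakUpperGradient.arc (hp : 0 < p) {g : X → ℝ≥0∞} (hg : IsWeakUpperGradient μ p u g) :
    AlmostEveryCurve μ p fun γ => ∀ c : ℝ → X, Continuous c → ∀ l : ℝ,
      HasUnitSpeedOn c (Icc 0 l) → (∀ ρ : X → ℝ≥0∞, γ.integral ρ = ∫⁻ t in Icc 0 l, ρ (c t)) →
      ∀ x y, 0 ≤ x → x ≤ y → y ≤ l → edist (u (c x)) (u (c y)) ≤ ∫⁻ t in Icc x y, g (c t) := by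
  refine (hg.2.arc hp).mono fun γ h c hc l hs hint x y hx hxy hy => ?_
  have hs' := hs.mono hx hy
  have := h c hc l hs hint x y hxy hx hy (Curve.rectifiable_arc hc hxy hs')
  rw [UpperGradientIneq, Curve.integral_arc hc hxy hs'] at this
  rwa [edist_comm]

theorem IsUpperGradient.isWeakUpperGradient (hp : 0 < p) {g : X → ℝ≥0∞}
    (hg : IsUpperGradient u g) : IsWeakUpperGradient μ p u g :=
  ⟨hg.1, (almostEveryCurve_iff hp).2 ⟨fun _ => 0, measurable_const,
    by simp [ENNReal.zero_rpow_of_pos hp], fun γ _ _ => hg.2 γ⟩⟩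

/-- A function with a `p`-integrable weak upper gradient has a `p`-integrable upper gradient. -/
theorem IsWeakUpperGradient.exists_isUpperGradient (hp : 0 < p) {g : X → ℝ≥0∞}
    (hg : IsWeakUpperGradient μ p u g) (hfin : ∫⁻ x, g x ^ p ∂μ < ∞) :
    ∃ g' : X → ℝ≥0∞, IsUpperGradient u g' ∧ ∫⁻ x, g' x ^ p ∂μ < ∞ := by
  obtain ⟨ρ, hρ, hρfin, hP⟩ := (almostEveryCurve_iff hp).1 hg.2
  -- On the exceptional curves `ρ` has infinite integral, so the inequality there is trivial.
  refine ⟨fun x => g x ⊔ ρ x, ⟨hg.1.sup hρ, fun γ hγ => ?_⟩, ?_⟩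
  · rcases eq_or_ne (γ.integral ρ) ∞ with htop | htop
    · have : γ.integral ρ ≤ γ.integral fun x => g x ⊔ ρ x :=
        Curve.integral_mono fun x => le_sup_right
      rw [htop, top_le_iff] at this
      rw [UpperGradientIneq, this]
      exact le_top
    · exact (hP γ hγ htop.lt_top hγ).trans (Curve.integral_mono fun x => le_sup_left)
  · calc ∫⁻ x, (g x ⊔ ρ x) ^ p ∂μ ≤ ∫⁻ x, g x ^ p + ρ x ^ p ∂μ :=
          lintegral_mono fun x => ENNReal.sup_rpow_le_add p _ _
      _ = ∫⁻ x, g x ^ p ∂μ + ∫⁻ x, ρ x ^ p ∂μ := lintegral_add_left (hg.1.pow_const p) _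
      _ < ∞ := ENNReal.add_lt_top.2 ⟨hfin, hρfin⟩

theorem IsWeakUpperGradient.rpow_mul_modulus_le (hp : 0 < p) {g : X → ℝ≥0∞}
    (hg : IsWeakUpperGradient μ p u g) {ε : ℝ} (hε : 0 < ε) :
    ENNReal.ofReal ε ^ p * modulus μ p (farEndpoints u ε) ≤ ∫⁻ x, g x ^ p ∂μ := by
  have he0 : ENNReal.ofReal ε ≠ 0 := (ENNReal.ofReal_pos.2 hε).ne'
  have her : (ENNReal.ofReal ε)⁻¹ ≠ ∞ := ENNReal.inv_ne_top.2 he0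
  have hmod : modulus μ p (farEndpoints u ε) ≤ ∫⁻ x, ((ENNReal.ofReal ε)⁻¹ * g x) ^ p ∂μ := by
    refine modulus_le_of_almostEveryCurve hp (hg.1.const_mul _)
      (hg.2.mono fun γ h hγ hr => ?_)
    rw [Curve.integral_const_mul her, ← ENNReal.inv_mul_cancel he0 ENNReal.ofReal_ne_top]
    gcongr
    refine le_trans ?_ (h hr)
    rw [edist_dist]
    exact ENNReal.ofReal_le_ofReal hγ
  calc ENNReal.ofReal ε ^ p * modulus μ p (farEndpoints u ε)
      ≤ ENNReal.ofReal ε ^ p * ∫⁻ x, ((ENNReal.ofReal ε)⁻¹ * g x) ^ p ∂μ := by gcongr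
    _ = ∫⁻ x, g x ^ p ∂μ := by
        rw [lintegral_const_mul_rpow hp her, ← mul_assoc, ← ENNReal.mul_rpow_of_nonneg _ _ hp.le,
          ENNReal.mul_inv_cancel he0 ENNReal.ofReal_ne_top, ENNReal.one_rpow, one_mul]

theorem IsWeakUpperGradient.almostEveryCurve_continuousAlong (hp : 0 < p) {g : X → ℝ≥0∞}
    (hg : IsWeakUpperGradient μ p u g) (hfin : ∫⁻ x, g x ^ p ∂μ < ∞) :
    AlmostEveryCurve μ p fun γ => ContinuousAlong u γ := by
  have hae := (hg.arc hp).and hp (almostEveryCurve_integral_lt_top hp hg.1 hfin)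
  obtain ⟨ρ, hρ, hρfin, hP⟩ := (almostEveryCurve_iff hp).1 hae
  -- Non-rectifiable curves need no argument, since admissibility does not test them.
  refine (almostEveryCurve_iff hp).2 ⟨ρ, hρ, hρfin, fun γ hγ hlt => ?_⟩
  obtain ⟨harc, hg'⟩ := hP γ hγ hlt
  obtain ⟨c, l, v, hc, hl, hs, -, -, hint, hv, hmaps, hcv⟩ := hγ.exists_unitSpeed
  have hlt' := hg' hγ
  rw [hint] at hlt'
  have hcont := continuousOn_of_edist_le_lintegral (f := u ∘ c) (hg.1.comp hc.measurable) hl hlt'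
    (harc c hc l hs hint)
  refine (hcont.comp hv hmaps).congr fun t ht => ?_
  simp only [Function.comp_apply, hcv t ht]

/-- By separability countably many open sets on which `g ^ p` is integrable cover `X`, so one
exceptional family handles all of them; a compact curve meets the need of finitely many only. -/
theorem LocallyLp.almostEveryCurve_integral_lt_top [TopologicalSpace.SeparableSpace X] (hp : 0 < p)
    {g : X → ℝ≥0∞} (hm : Measurable g) (hg : LocallyLp μ p g) :
    AlmostEveryCurve μ p fun γ => γ.Rectifiable → γ.integral g < ∞ := by
  have : SecondCountableTopology X := UniformSpace.secondCountable_of_separable X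
  choose U hU hfin using hg
  obtain ⟨s, hs, hcover⟩ := TopologicalSpace.countable_cover_nhds
    fun x => interior_mem_nhds.2 (hU x)
  have := hs.to_subtype
  have hmeas : ∀ i : s, Measurable ((interior (U i)).indicator g) := fun i =>
    hm.indicator isOpen_interior.measurableSet
  have hall := AlmostEveryCurve.all hp fun i : s =>
    CurveModulus.almostEveryCurve_integral_lt_top (μ := μ) hp (hmeas i) (by
      have : ∀ x, (interior (U i)).indicator g x ^ p =
          (interior (U i)).indicator (fun x => g x ^ p) x := fun x => by
        by_cases hx : x ∈ interior (U i)
        · simp [hx]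
        · simp [hx, ENNReal.zero_rpow_of_pos hp]
      simp_rw [this]
      rw [lintegral_indicator isOpen_interior.measurableSet]
      exact (lintegral_mono_set interior_subset).trans_lt (hfin i))
  refine hall.mono fun γ h hγ => ?_
  obtain ⟨c, l, -, hc, -, -, -, -, hint, -⟩ := hγ.exists_unitSpeed
  obtain ⟨t, ht⟩ := ((isCompact_Icc (a := (0 : ℝ)) (b := l)).image hc).elim_finite_subcover
    (fun i : s => interior (U i)) (fun _ => isOpen_interior) (by
      rw [← biUnion_eq_iUnion s fun x _ => interior (U x), hcover]
      exact subset_univ _)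
  calc γ.integral g = ∫⁻ τ in Icc 0 l, g (c τ) := hint g
    _ ≤ ∫⁻ τ in Icc 0 l, ∑ i ∈ t, (interior (U i)).indicator g (c τ) := by
        refine setLIntegral_mono' measurableSet_Icc fun τ hτ => ?_
        obtain ⟨i, hi, hmem⟩ := mem_iUnion₂.1 (ht (mem_image_of_mem c hτ))
        calc g (c τ) = (interior (U i)).indicator g (c τ) := (indicator_of_mem hmem g).symm
          _ ≤ _ := Finset.single_le_sum (f := fun i : s => (interior (U i)).indicator g (c τ))
            (fun _ _ => zero_le) hi
    _ = ∑ i ∈ t, γ.integral ((interior (U i)).indicator g) := by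
        rw [lintegral_finsetSum (f := fun (i : s) τ => (interior (U i)).indicator g (c τ)) _
          fun i _ => (hmeas i).comp hc.measurable]
        exact Finset.sum_congr rfl fun i _ => (hint _).symm
    _ < ∞ := ENNReal.sum_lt_top.2 fun i _ => h i hγ

/-- The minimum of two locally `p`-integrable weak upper gradients is a weak upper gradient. -/
theorem IsWeakUpperGradient.min [TopologicalSpace.SeparableSpace X] (hp : 0 < p)
    {g g' : X → ℝ≥0∞} (hg : IsWeakUpperGradient μ p u g) (hgL : LocallyLp μ p g)
    (hg' : IsWeakUpperGradient μ p u g') (hgL' : LocallyLp μ p g') :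
    IsWeakUpperGradient μ p u fun x => min (g x) (g' x) := by
  refine ⟨hg.1.min hg'.1, ?_⟩
  refine (((hg.arc hp).and hp (hg'.arc hp)).and hp
    ((hgL.almostEveryCurve_integral_lt_top hp hg.1).and hp
      (hgL'.almostEveryCurve_integral_lt_top hp hg'.1))).mono fun γ h hγ => ?_
  obtain ⟨⟨harc, harc'⟩, hfin, hfin'⟩ := h
  obtain ⟨c, l, -, hc, hl, hs, h0, h1, hint, -⟩ := hγ.exists_unitSpeed
  have hlt := hfin hγ
  have hlt' := hfin' hγ
  rw [hint] at hlt hlt'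
  rw [UpperGradientIneq, ← h0, ← h1, edist_comm, hint]
  exact edist_le_lintegral_min (f := u ∘ c) (hg.1.comp hc.measurable) (hg'.1.comp hc.measurable)
    hl hlt hlt' (harc c hc l hs hint) (harc' c hc l hs hint)

/-! ### From modulus bounds to weak upper gradients, and the theorem. -/

/-- An admissible function for the curves with far endpoints is, after rescaling, an upper gradient
up to an error. -/
theorem Admissible.edist_le_add {ε : ℝ} (hε : 0 < ε) {ρ : X → ℝ≥0∞}
    (hρ : Admissible (farEndpoints u ε) ρ) {γ : Curve X} (hγ : γ.Rectifiable)
    (hfin : γ.integral ρ < ∞) :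
    edist (u (γ.toFun γ.right)) (u (γ.toFun γ.left)) ≤
      γ.integral (fun x => ENNReal.ofReal ε * ρ x) + ENNReal.ofReal ε := by
  obtain ⟨c, l, -, hc, hl, hs, h0, h1, hint, -⟩ := hγ.exists_unitSpeed
  have hfin' : γ.integral (fun x => ENNReal.ofReal ε * ρ x) < ∞ := by
    rw [Curve.integral_const_mul ENNReal.ofReal_ne_top]
    exact ENNReal.mul_lt_top ENNReal.ofReal_lt_top hfin
  rw [hint] at hfin'
  rw [← h0, ← h1, edist_comm, hint]
  refine edist_le_lintegral_add_of_lt (f := u ∘ c) ((hρ.1.const_mul _).comp hc.measurable) hl hε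
    hfin' fun x y hx hxy hy hlt => ?_
  -- Otherwise the arc is in the family, so `ρ` has integral at least 1 on it and `ε * ρ` at least
  -- ε.
  by_contra! hfar
  have hs' := hs.mono hx hy
  have hmem : Curve.arc c hc x y hxy ∈ farEndpoints u ε := by
    change ε ≤ dist (u (c y)) (u (c x))
    rwa [dist_comm]
  have hone := hρ.2 _ hmem (Curve.rectifiable_arc hc hxy hs')
  rw [Curve.integral_arc hc hxy hs'] at hone
  simp only [Function.comp_apply] at hlt
  rw [lintegral_const_mul' _ _ ENNReal.ofReal_ne_top] at hlt
  exact absurd hlt (not_lt.2 (le_mul_of_one_le_right zero_le hone))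

/-- Bounds on the modulus of the families of curves with far endpoints at small scales yield a weak
upper gradient. -/
theorem exists_isWeakUpperGradient_of_modulus (hp : 1 < p) {L : ℝ≥0∞} (hL : L ≠ ∞)
    (h : ∀ δ : ℝ, 0 < δ → ∀ M > L, ∃ ε : ℝ, 0 < ε ∧ ε < δ ∧
      ENNReal.ofReal ε ^ p * modulus μ p (farEndpoints u ε) < M) :
    ∃ g : X → ℝ≥0∞, IsWeakUpperGradient μ p u g ∧ ∫⁻ x, g x ^ p ∂μ ≤ L := by
  have hp0 : 0 < p := zero_lt_one.trans hp
  set δ : ℕ → ℝ≥0∞ := fun n => ((n + 1 : ℕ) : ℝ≥0∞)⁻¹ with hδ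
  have hδlim : Tendsto δ atTop (𝓝 0) :=
    ENNReal.tendsto_inv_nat_nhds_zero.comp (tendsto_add_atTop_nat 1)
  have hδanti : Antitone δ := fun n m hnm =>
    ENNReal.inv_le_inv.2 (Nat.cast_le.2 (Nat.succ_le_succ hnm))
  set 𝒞 : ℕ → Set (X → ℝ≥0∞) := fun n => {G | Measurable G ∧ AlmostEveryCurve μ p fun γ =>
    γ.Rectifiable → edist (u (γ.toFun γ.right)) (u (γ.toFun γ.left)) ≤ γ.integral G + δ n}
  have hanti : Antitone 𝒞 := fun n m hnm G hG =>
    ⟨hG.1, hG.2.mono fun γ hγ hr => (hγ hr).trans (by gcongr; exact hδanti hnm)⟩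
  have hmid : ∀ n, ∀ f ∈ 𝒞 n, ∀ g ∈ 𝒞 n, (fun x => (f x + g x) / 2) ∈ 𝒞 n := by
    intro n f hf g hg
    refine ⟨(hf.1.add hg.1).div_const 2, (hf.2.and hp0 hg.2).mono fun γ hγ hr => ?_⟩
    have h2 : (2 : ℝ≥0∞)⁻¹ ≠ ∞ := ENNReal.inv_ne_top.2 two_ne_zero
    have hi : γ.integral (fun x => (f x + g x) / 2) = 2⁻¹ * (γ.integral f + γ.integral g) := by
      rw [← hr.integral_add hf.1, ← Curve.integral_const_mul h2]
      simp only [div_eq_mul_inv, mul_comm]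
    set E := edist (u (γ.toFun γ.right)) (u (γ.toFun γ.left))
    have h22 : (2 : ℝ≥0∞)⁻¹ * 2 = 1 := ENNReal.inv_mul_cancel two_ne_zero ENNReal.ofNat_ne_top
    rw [hi]
    calc E = 2⁻¹ * (E + E) := by rw [← two_mul, ← mul_assoc, h22, one_mul]
      _ ≤ 2⁻¹ * ((γ.integral f + δ n) + (γ.integral g + δ n)) := by
          gcongr
          exacts [hγ.1 hr, hγ.2 hr]
      _ = 2⁻¹ * (γ.integral f + γ.integral g) + (2⁻¹ * 2) * δ n := by ring
      _ = _ := by rw [h22, one_mul]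
  have hex : ∀ n, ∀ M > L, ∃ f ∈ 𝒞 n, ∫⁻ x, f x ^ p ∂μ < M := by
    intro n M hM
    obtain ⟨ε, hε, hεδ, hlt⟩ := h (1 / ((n : ℝ) + 1)) (by positivity) M hM
    have hεδ' : ENNReal.ofReal ε ≤ δ n := by
      simp only [hδ]
      rw [← ENNReal.ofReal_natCast, ← ENNReal.ofReal_inv_of_pos (by positivity)]
      refine ENNReal.ofReal_le_ofReal (hεδ.le.trans_eq ?_)
      push_cast
      rw [one_div]
    have hε0 : ENNReal.ofReal ε ^ p ≠ 0 := by
      simp [ENNReal.rpow_eq_zero_iff, hε, hp0.not_gt]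
    have hεtop : ENNReal.ofReal ε ^ p ≠ ∞ :=
      ENNReal.rpow_ne_top_of_nonneg hp0.le ENNReal.ofReal_ne_top
    rw [mul_comm, ← ENNReal.lt_div_iff_mul_lt (Or.inl hε0) (Or.inl hεtop)] at hlt
    obtain ⟨ρ, hρ, hρlt⟩ := exists_admissible_of_modulus_lt hlt
    refine ⟨fun x => ENNReal.ofReal ε * ρ x, ⟨hρ.1.const_mul _,
      (almostEveryCurve_integral_lt_top hp0 hρ.1 (hρlt.trans_le le_top)).mono fun γ hγ hr =>
        (hρ.edist_le_add hε hr (hγ hr)).trans (by gcongr)⟩, ?_⟩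
    rw [lintegral_const_mul_rpow hp0 ENNReal.ofReal_ne_top, mul_comm]
    exact (ENNReal.lt_div_iff_mul_lt (Or.inl hε0) (Or.inl hεtop)).1 hρlt
  obtain ⟨H, a, g, hH, ha, hg, hgL, hafin, hle⟩ :=
    exists_selection_of_midpoint_mem hp hanti (fun n f hf => hf.1) hmid hL hex
  refine ⟨g, ⟨hg, ((AlmostEveryCurve.all hp0 fun n => (hH n).2).and hp0
    (almostEveryCurve_integral_lt_top hp0 (Measurable.tsum ha) hafin)).mono
      fun γ hγ hr => ?_⟩, hgL⟩
  have hfin := hγ.2 hr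
  rw [hr.integral_tsum ha] at hfin
  have hlim := ((ENNReal.tendsto_sum_nat_add (fun n => γ.integral (a n)) hfin.ne).const_add
    (γ.integral g)).add hδlim
  rw [add_zero, add_zero] at hlim
  refine ge_of_tendsto' hlim fun n => (hγ.1 n hr).trans ?_
  gcongr
  calc γ.integral (H n) ≤ γ.integral fun x => g x + ∑' j, a (j + n) x :=
        Curve.integral_mono fun x => hle n x
    _ = _ := by rw [hr.integral_add hg, hr.integral_tsum fun j => ha (j + n)]

theorem exists_isWeakUpperGradient_of_liminf_lt_top (hp : 1 < p)
    (h : liminf (fun ε : ℝ => ENNReal.ofReal ε ^ p * modulus μ p (farEndpoints u ε)) (𝓝[>] 0) < ∞) :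
    ∃ g : X → ℝ≥0∞, IsWeakUpperGradient μ p u g ∧ ∫⁻ x, g x ^ p ∂μ ≤
      liminf (fun ε : ℝ => ENNReal.ofReal ε ^ p * modulus μ p (farEndpoints u ε)) (𝓝[>] 0) := by
  refine exists_isWeakUpperGradient_of_modulus hp h.ne fun δ hδ M hM => ?_
  obtain ⟨ε, hlt, hε⟩ := ((frequently_lt_of_liminf_lt (by isBoundedDefault) hM).and_eventually
    (Ioo_mem_nhdsGT hδ)).exists
  exact ⟨ε, hε.1, hε.2, hlt⟩

theorem IsWeakUpperGradient.eventually_rpow_mul_modulus_le (hp : 0 < p) {g : X → ℝ≥0∞}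
    (hg : IsWeakUpperGradient μ p u g) :
    ∀ᶠ ε : ℝ in 𝓝[>] 0, ENNReal.ofReal ε ^ p * modulus μ p (farEndpoints u ε) ≤
      ∫⁻ x, g x ^ p ∂μ := by
  filter_upwards [self_mem_nhdsWithin] with ε hε using hg.rpow_mul_modulus_le hp hε

theorem IsWeakUpperGradient.liminf_le (hp : 0 < p) {g : X → ℝ≥0∞}
    (hg : IsWeakUpperGradient μ p u g) :
    liminf (fun ε : ℝ => ENNReal.ofReal ε ^ p * modulus μ p (farEndpoints u ε)) (𝓝[>] 0) ≤
      ∫⁻ x, g x ^ p ∂μ :=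
  (liminf_le_liminf (hg.eventually_rpow_mul_modulus_le hp)).trans_eq (liminf_const _)

theorem memNewtonSobolev_iff_liminf_lt_top (hp : 1 < p) (huLp : MemLpMetric μ p u) :
    MemNewtonSobolev μ p u ↔
      liminf (fun ε : ℝ => ENNReal.ofReal ε ^ p * modulus μ p (farEndpoints u ε)) (𝓝[>] 0) < ∞ := by
  have hp0 : 0 < p := zero_lt_one.trans hp
  constructor
  · rintro ⟨-, g, hg, hfin⟩
    exact ((hg.isWeakUpperGradient hp0).liminf_le hp0).trans_lt hfin
  · intro h
    obtain ⟨g, hg, hle⟩ := exists_isWeakUpperGradient_of_liminf_lt_top hp h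
    exact ⟨huLp, hg.exists_isUpperGradient hp0 (hle.trans_lt h)⟩

theorem MemNewtonSobolev.almostEveryCurve_continuousAlong (hp : 0 < p)
    (h : MemNewtonSobolev μ p u) : AlmostEveryCurve μ p fun γ => ContinuousAlong u γ := by
  obtain ⟨-, g, hg, hfin⟩ := h
  exact (hg.isWeakUpperGradient hp).almostEveryCurve_continuousAlong hp hfin

theorem modulus_preimageFamily_bigCurves (hp : 0 < p)
    (h : AlmostEveryCurve μ p fun γ => ContinuousAlong u γ) (ε : ℝ) :
    modulus μ p (preimageFamily u (bigCurves Z ε)) = modulus μ p (farEndpoints u ε) := by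
  refine le_antisymm (le_iInf₂ fun ρ hρ => modulus_le ⟨hρ.1, ?_⟩)
    (modulus_mono_of_almostEveryCurve hp (h.mono fun γ hc hγ _ => ⟨hc, hγ⟩))
  rintro γ ⟨_, hγ⟩
  exact hρ.2 γ hγ

theorem MemNewtonSobolev.exists_isMinimalWeakUpperGradient [TopologicalSpace.SeparableSpace X]
    (hp : 1 < p) (h : MemNewtonSobolev μ p u) :
    ∃ g : X → ℝ≥0∞, IsMinimalWeakUpperGradient μ p u g := by
  have hp0 : 0 < p := zero_lt_one.trans hp
  have hlt := (memNewtonSobolev_iff_liminf_lt_top hp h.1).1 h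
  obtain ⟨g, hg, hle⟩ := exists_isWeakUpperGradient_of_liminf_lt_top hp hlt
  have hfin : ∫⁻ x, g x ^ p ∂μ < ∞ := hle.trans_lt hlt
  have hgL : LocallyLp μ p g := fun x => ⟨univ, univ_mem, by rwa [Measure.restrict_univ]⟩
  refine ⟨g, hg, hgL, fun g' hg' hgL' => ?_⟩
  have hmin := hg.min hp0 hgL hg' hgL'
  have hmono : ∀ x, min (g x) (g' x) ^ p ≤ g x ^ p := fun x =>
    ENNReal.rpow_le_rpow (min_le_left _ _) hp0.le
  -- The integral of `g ^ p` is at most the lower limit, which is at most that of `min g g' ^ p`;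
  -- the pointwise inequality is therefore an equality almost everywhere.
  have heq := ae_eq_of_ae_le_of_lintegral_le (μ := μ) (Eventually.of_forall hmono)
    ((lintegral_mono hmono).trans_lt hfin).ne (hg.1.pow_const p).aemeasurable
    (hle.trans (hmin.liminf_le hp0))
  filter_upwards [heq] with x hx
  have hx' : min (g x) (g' x) = g x := ENNReal.rpow_left_injective hp0.ne' hx
  exact min_eq_left_iff.1 hx'

/-- The upper limit is at most $\int g^p$ because `g` is a weak upper gradient. The lower limit
bounds $\int g'^p$ for some weak upper gradient `g'`, and minimality gives `g ≤ g'` almost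
everywhere. -/
theorem IsMinimalWeakUpperGradient.tendsto_rpow_mul_modulus (hp : 1 < p)
    (h : MemNewtonSobolev μ p u) {g : X → ℝ≥0∞} (hg : IsMinimalWeakUpperGradient μ p u g) :
    Tendsto (fun ε : ℝ => ENNReal.ofReal ε ^ p * modulus μ p (farEndpoints u ε))
      (𝓝[>] 0) (𝓝 (∫⁻ x, g x ^ p ∂μ)) := by
  have hp0 : 0 < p := zero_lt_one.trans hp
  have hlt := (memNewtonSobolev_iff_liminf_lt_top hp h.1).1 h
  obtain ⟨g', hg', hle⟩ := exists_isWeakUpperGradient_of_liminf_lt_top hp hlt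
  have hgL' : LocallyLp μ p g' := fun x =>
    ⟨univ, univ_mem, by rw [Measure.restrict_univ]; exact hle.trans_lt hlt⟩
  refine tendsto_of_le_liminf_of_limsup_le (le_trans (lintegral_mono_ae ?_) hle) ?_
  · filter_upwards [hg.2.2 g' hg' hgL'] with x hx using ENNReal.rpow_le_rpow hx hp0.le
  · exact (limsup_le_limsup (hg.1.eventually_rpow_mul_modulus_le hp0)).trans_eq (limsup_const _)

end CurveModulus

theorem mainTheorem2 {X Z : Type*}
    [MetricSpace X] [TopologicalSpace.SeparableSpace X] [MeasurableSpace X] [BorelSpace X]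
    (μ : Measure X) [IsLocallyFiniteMeasure μ] [μ.IsOpenPosMeasure]
    [MetricSpace Z] [MeasurableSpace Z] [BorelSpace Z]
    (p : ℝ) (hp : 1 < p) (u : X → Z) (hu : Measurable u) (huLp : MemLpMetric μ p u) :
    (MemNewtonSobolev μ p u ↔
      liminf (fun ε : ℝ => ENNReal.ofReal ε ^ p * modulus μ p (farEndpoints u ε)) (𝓝[>] 0) < ∞) ∧
    ((AlmostEveryCurve μ p fun γ => ContinuousAlong u γ) →
      (MemNewtonSobolev μ p u ↔
        liminf (fun ε : ℝ =>
          ENNReal.ofReal ε ^ p * modulus μ p (preimageFamily u (bigCurves Z ε))) (𝓝[>] 0) < ∞)) ∧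
    (MemNewtonSobolev μ p u →
      (∃ g : X → ℝ≥0∞, IsMinimalWeakUpperGradient μ p u g) ∧
      ∀ g : X → ℝ≥0∞, IsMinimalWeakUpperGradient μ p u g →
        Tendsto (fun ε : ℝ => ENNReal.ofReal ε ^ p * modulus μ p (farEndpoints u ε))
          (𝓝[>] 0) (𝓝 (∫⁻ x, g x ^ p ∂μ)) ∧
        Tendsto (fun ε : ℝ =>
            ENNReal.ofReal ε ^ p * modulus μ p (preimageFamily u (bigCurves Z ε)))
          (𝓝[>] 0) (𝓝 (∫⁻ x, g x ^ p ∂μ))) := by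
  have hp0 : 0 < p := zero_lt_one.trans hp
  refine ⟨memNewtonSobolev_iff_liminf_lt_top hp huLp, fun hc => ?_, fun h => ?_⟩
  · simp_rw [modulus_preimageFamily_bigCurves hp0 hc]
    exact memNewtonSobolev_iff_liminf_lt_top hp huLp
  · refine ⟨h.exists_isMinimalWeakUpperGradient hp, fun g hg => ?_⟩
    simp_rw [modulus_preimageFamily_bigCurves hp0 (h.almostEveryCurve_continuousAlong hp0)]
    exact ⟨hg.tendsto_rpow_mul_modulus hp h, hg.tendsto_rpow_mul_modulus hp h⟩
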